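/- Let $F_3$ be the free group on $a_1,a_2,a_3$ and let $\mathrm{Out}(F_3)$ be its outer automorphism group, with automorphisms composed as maps acting on the left. Write $\epsilon_i$ for the class of the automorphism $a_i\mapsto a_i^{-1}$, $a_k\mapsto a_k$ $(k\ne i)$, and $\rho_{21}$ for the class of $a_2\mapsto a_2a_1$, $a_1\mapsto a_1$, $a_3\mapsto a_3$. Let $\mathbb K$ be a field with $\mathrm{char}(\mathbb K)\neq 2$ and let $V$ be a six-dimensional $\mathbb K$-linear representation of $\mathrm{Out}(F_3)$. For $I\subseteq\{1,2,3\}$ put $$E_I=\{v\in V \mid \epsilon_i v=-v \text{ for } i\in I,\ \epsilon_i v=v \text{ for } i\notin I\},\qquad V_m=\bigoplus_{|I|=m}E_I ,$$ so that $V=\bigoplus_I E_I$, and let $p_J:V\to E_J$ be the projections of this decomposition. Write $E_i=E_{\{i\}}$, $E_{i,j}=E_{\{i,j\}}$; thus $V_0=E_\emptyset$ and $V_3=E_{\{1,2,3\}}$. A directed graph $D$ whose vertices are subsets of $\{1,2,3\}$ is a *diagram for* $x\in\mathrm{Out}(F_3)$ if every $I$ with $E_I\ne 0$ is a vertex of $D$,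 and $D$ has an edge from $I$ to $J$ whenever $p_J(x(E_I))\neq 0$. (In describing diagrams below we name the vertex $I$ by $E_I$; there is a loop at every vertex, and $\leftrightarrow$ stands for edges in both directions.) Suppose that $\dim (V_1\oplus V_2)\le 3$. Then $V_1=0$ or $V_2=0$, and: 1. If $V_2=0$, then $\rho_{21}$ has a diagram with vertices $V_3,E_1,E_2,E_3,V_0$ whose edges other than loops are either (a) $V_3\leftrightarrow E_3$, $E_2\to E_1$, $V_0\to E_1$, or (b) $V_3\leftrightarrow E_3$, $E_1\to E_2$, $E_1\to V_0$. 2. If $V_1=0$, then $\rho_{21}$ has a diagram with vertices $V_3,E_{2,3},E_{1,3},E_{1,2},V_0$ whose edges other than loops are either (a) $V_0\leftrightarrow E_{1,2}$, $E_{1,3}\to E_{2,3}$, $V_3\to E_{2,3}$, or (b) $V_0\leftrightarrow E_{1,2}$, $E_{2,3}\to E_{1,3}$, $E_{2,3}\to V_3$. 3. At least one of $V_0\oplus V_2$ and $V_1\oplus V_3$ is $\mathrm{Out}(F_3)$-invariant. -/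

import Mathlib

namespace OutFree

/-- The inner automorphisms form a normal subgroup of the automorphism group. -/
instance innNormal (G : Type*) [Group G] : (MulAut.conj (G := G)).range.Normal where
  conj_mem := by
    rintro _ ⟨g, rfl⟩ f
    refine ⟨f g, ?_⟩
    ext x
    simp [MulAut.conj_apply, MulAut.mul_apply]

/-- `Out(F_n)`: automorphisms of the free group on `n` letters modulo inner automorphisms. The
product in `MulAut` is composition, so automorphisms act on the left. The free generators
`a_1, …, a_n` are indexed by `Fin n`, that is, by `0, …, n - 1`. -/
abbrev Out (n : ℕ) : Type :=
  MulAut (FreeGroup (Fin n)) ⧸ (MulAut.conj (G := FreeGroup (Fin n))).range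

/-- The endomorphism `a_i ↦ a_i⁻¹`, `a_k ↦ a_k` for `k ≠ i`. -/
def epsHom {n : ℕ} (i : Fin n) : FreeGroup (Fin n) →* FreeGroup (Fin n) :=
  FreeGroup.lift fun k => if k = i then (FreeGroup.of k)⁻¹ else FreeGroup.of k

theorem epsHom_comp {n : ℕ} (i : Fin n) : (epsHom i).comp (epsHom i) = MonoidHom.id _ := by
  ext k
  by_cases h : k = i <;> simp [epsHom, h]

/-- The automorphism `ε_i : a_i ↦ a_i⁻¹`, `a_k ↦ a_k` for `k ≠ i`. -/
def epsAut {n : ℕ} (i : Fin n) : MulAut (FreeGroup (Fin n)) :=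
  MonoidHom.toMulEquiv (epsHom i) (epsHom i) (epsHom_comp i) (epsHom_comp i)

/-- The endomorphism `a_i ↦ a_i * u`, `a_k ↦ a_k` for `k ≠ i`. -/
def transvHom {n : ℕ} (i : Fin n) (u : FreeGroup (Fin n)) :
    FreeGroup (Fin n) →* FreeGroup (Fin n) :=
  FreeGroup.lift fun k => if k = i then FreeGroup.of k * u else FreeGroup.of k

/-- The automorphism `ρ_{ij} : a_i ↦ a_i a_j`, `a_k ↦ a_k` for `k ≠ i`. -/
def rhoAut {n : ℕ} (i j : Fin n) (h : i ≠ j) : MulAut (FreeGroup (Fin n)) :=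
  MonoidHom.toMulEquiv (transvHom i (FreeGroup.of j)) (transvHom i (FreeGroup.of j)⁻¹)
    (by ext k; by_cases hk : k = i <;> simp [transvHom, hk, h.symm])
    (by ext k; by_cases hk : k = i <;> simp [transvHom, hk, h.symm])

/-- The class of `ε_i` in `Out(F_n)`. -/
def eps {n : ℕ} (i : Fin n) : Out n := QuotientGroup.mk (epsAut i)

/-- The class of `ρ_{ij}` in `Out(F_n)`. -/
def rho {n : ℕ} (i j : Fin n) (h : i ≠ j) : Out n := QuotientGroup.mk (rhoAut i j h)

section Representations

variable {n : ℕ} {K V : Type*} [Field K] [AddCommGroup V] [Module K V]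

/-- `E_I = {v | ε_i v = (-1)^{χ_I(i)} v for all i}`. -/
def weightSpace (φ : Representation K (Out n) V) (I : Finset (Fin n)) : Submodule K V :=
  ⨅ i : Fin n, Module.End.eigenspace (φ (eps i)) (if i ∈ I then -1 else 1)

/-- `V_m`, the sum of the spaces `E_I` with `|I| = m`. -/
def level (φ : Representation K (Out n) V) (m : ℕ) : Submodule K V :=
  ⨆ (I : Finset (Fin n)) (_ : I.card = m), weightSpace φ I

/-- `W` is an `Out(F_n)`-invariant subspace. -/
def IsInvariant (φ : Representation K (Out n) V) (W : Submodule K V) : Prop :=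
  ∀ g : Out n, ∀ v ∈ W, φ g v ∈ W

end Representations

/-- Directed graphs (loops allowed) whose vertices are subsets of `{1, …, n}`. -/
@[ext]
structure Diagram (n : ℕ) where
  verts : Set (Finset (Fin n))
  edge : Finset (Fin n) → Finset (Fin n) → Prop
  edge_fst : ∀ {I J}, edge I J → I ∈ verts
  edge_snd : ∀ {I J}, edge I J → J ∈ verts

/-- `D` is a subgraph of `D'`. -/
def Diagram.IsSubgraph {n : ℕ} (D D' : Diagram n) : Prop :=
  D.verts ⊆ D'.verts ∧ ∀ I J, D.edge I J → D'.edge I J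

/-- The graph on a given set of vertices which has a loop at every vertex and, besides the loops,
exactly the listed edges `(I, J)` (from `I` to `J`). -/
def Diagram.withLoops {n : ℕ} (S : Set (Finset (Fin n)))
    (L : Set (Finset (Fin n) × Finset (Fin n))) : Diagram n where
  verts := S
  edge I J := I ∈ S ∧ J ∈ S ∧ (I = J ∨ (I, J) ∈ L)
  edge_fst h := h.1
  edge_snd h := h.2.1

/-- The minimal diagram for `x`. The vertices are the `I` with `E_I ≠ 0`; there is an edge from `I`
to `J` iff `p_J (x (E_I)) ≠ 0`, that is, iff for some `v ∈ E_I` the vector `x v` has a nonzero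
component in `E_J` when it is written as a sum of vectors `w_L ∈ E_L` (which is possible in
exactly one way when the characteristic is not `2`). -/
def minimalDiagram {n : ℕ} {K V : Type*} [Field K] [AddCommGroup V] [Module K V]
    (φ : Representation K (Out n) V) (x : Out n) : Diagram n where
  verts := {I | weightSpace φ I ≠ ⊥}
  edge I J := weightSpace φ I ≠ ⊥ ∧ weightSpace φ J ≠ ⊥ ∧
    ∃ v ∈ weightSpace φ I, ∃ w : (L : Finset (Fin n)) → weightSpace φ L,
      φ x v = ∑ L, (w L : V) ∧ w J ≠ 0
  edge_fst h := h.1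
  edge_snd h := h.2.1

/-- `D` is a (not necessarily minimal) diagram for `x`. -/
def IsDiagramFor {n : ℕ} {K V : Type*} [Field K] [AddCommGroup V] [Module K V]
    (φ : Representation K (Out n) V) (x : Out n) (D : Diagram n) : Prop :=
  (minimalDiagram φ x).IsSubgraph D

/-! The four diagrams below are for `n = 3`. With indices shifted by one, `{0}, {1}, {2}` stand for
`E_1, E_2, E_3`, the sets `{1, 2}, {0, 2}, {0, 1}` for `E_{2,3}, E_{1,3}, E_{1,2}`, while `∅` stands
for `V_0` and `{0, 1, 2}` for `V_3`. -/

/-- Vertices `V_3`, `E_1`, `E_2`, `E_3`, `V_0`. -/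
def lowVerts : Set (Finset (Fin 3)) := {{0, 1, 2}, {0}, {1}, {2}, ∅}

/-- Vertices `V_3`, `E_{2,3}`, `E_{1,3}`, `E_{1,2}`, `V_0`. -/
def highVerts : Set (Finset (Fin 3)) := {{0, 1, 2}, {1, 2}, {0, 2}, {0, 1}, ∅}

/-- `V_3 ↔ E_3`, `E_2 → E_1`, `V_0 → E_1`. -/
def lowDiagramIn : Diagram 3 :=
  Diagram.withLoops lowVerts {({0, 1, 2}, {2}), ({2}, {0, 1, 2}), ({1}, {0}), (∅, {0})}

/-- `V_3 ↔ E_3`, `E_1 → E_2`, `E_1 → V_0`. -/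
def lowDiagramOut : Diagram 3 :=
  Diagram.withLoops lowVerts {({0, 1, 2}, {2}), ({2}, {0, 1, 2}), ({0}, {1}), ({0}, ∅)}

/-- `V_0 ↔ E_{1,2}`, `E_{1,3} → E_{2,3}`, `V_3 → E_{2,3}`. -/
def highDiagramIn : Diagram 3 :=
  Diagram.withLoops highVerts {(∅, {0, 1}), ({0, 1}, ∅), ({0, 2}, {1, 2}), ({0, 1, 2}, {1, 2})}

/-- `V_0 ↔ E_{1,2}`, `E_{2,3} → E_{1,3}`, `E_{2,3} → V_3`. -/
def highDiagramOut : Diagram 3 :=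
  Diagram.withLoops highVerts {(∅, {0, 1}), ({0, 1}, ∅), ({1, 2}, {0, 2}), ({1, 2}, {0, 1, 2})}

end OutFree

/-! Numbering of spaces and generators starts at 1 in these comments and at 0 in the code; T denotes
ρ_21.

Permutations of the generators permute the E_I, so dim E_I depends only on |I|. Hence 3 dim E_1 + 3
dim E_{1,2} ≤ 3: one of V_1, V_2 vanishes and the other has components of dimension at most 1.
Tensoring with the determinant fixes T and exchanges complementary index sets, so V_2 = 0 is the
only case to treat.

There T commutes with ε_3, hence preserves V_3 ⊕ E_3 and V_0 ⊕ E_1 ⊕ E_2. On the first block ε_1 and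
ε_2 agree, so T ε_2 T ε_2, the partial conjugation of a_2 by a_1, equals T ε_1 T ε_1 = 1 there.
Partial conjugation of a_2 and of a_3 by a_1 compose to an inner automorphism, which transports this
triviality to E_2 and excludes the edges E_2 → V_0 (`T_e₁`) and V_0 → E_2 (`T_z`). It remains to see
that E_1 does not have both incoming and outgoing edges (`IsFrame.dichotomy`). Since T⁻¹ = ε_1 T
ε_1, such a pair would be either E_1 ↔ E_2, against the Steinberg relation (`not_e₀_e₁`), or E_1 ↔
V_0 (`not_e₀_empty`). The latter produces two independent vectors in V_3; dimension six leaves no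
room for a third, and a relation of order three then fails.

For the invariance, the diagram shows that T preserves one of the two sums, as do sign changes and
permutations. By Nielsen's theorem (`subgroup_eq_top`) these generate. Its proof takes an
automorphism of minimal complexity in a coset: the images of the generators are then Nielsen
reduced, so no word gets shorter and the automorphism is a signed permutation. -/

namespace OutFree

open Equiv (swap)

/-! ### Common prefixes and numerical codes of words -/

section CommonPrefix

variable {β : Type*} [DecidableEq β]

/-- The length of the longest common prefix of two lists. -/
def commonPrefixLength : List β → List β → ℕ
  | a :: l, b :: m => if a = b then commonPrefixLength l m + 1 else 0
  | [], _ => 0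
  | _ :: _, [] => 0

theorem le_commonPrefixLength_iff (n : ℕ) (l m : List β) :
    n ≤ commonPrefixLength l m ↔ n ≤ l.length ∧ n ≤ m.length ∧ l.take n = m.take n := by
  induction l generalizing m n with
  | nil => cases n <;> simp [commonPrefixLength]
  | cons a l ih =>
    cases m with
    | nil => cases n <;> simp [commonPrefixLength]
    | cons b m =>
      cases n with
      | zero => simp
      | succ n =>
        by_cases h : a = b
        · simp [commonPrefixLength, h, ih]
        · simp [commonPrefixLength, h]

theorem commonPrefixLength_comm (l m : List β) :
    commonPrefixLength l m = commonPrefixLength m l := by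
  refine eq_of_forall_le_iff fun n => ?_
  rw [le_commonPrefixLength_iff, le_commonPrefixLength_iff]
  tauto

/-- The ultrametric inequality: initial segments shared with `m` are shared with each other. -/
theorem min_commonPrefixLength_le (l m k : List β) :
    min (commonPrefixLength l m) (commonPrefixLength m k) ≤ commonPrefixLength l k := by
  obtain ⟨h1, -, h2⟩ := (le_commonPrefixLength_iff _ l m).1
    (min_le_left (commonPrefixLength l m) (commonPrefixLength m k))
  obtain ⟨-, h3, h4⟩ := (le_commonPrefixLength_iff _ m k).1
    (min_le_right (commonPrefixLength l m) (commonPrefixLength m k))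
  exact (le_commonPrefixLength_iff _ _ _).2 ⟨h1, h3, h2.trans h4⟩

theorem commonPrefixLength_eq_of_lt {l m k : List β}
    (h : commonPrefixLength l m < commonPrefixLength k m) :
    commonPrefixLength l k = commonPrefixLength l m := by
  have h1 := min_commonPrefixLength_le l m k
  have h2 := min_commonPrefixLength_le l k m
  rw [commonPrefixLength_comm m k] at h1
  omega

end CommonPrefix

section Code

variable {β : Type*} [Fintype β]

/-- Words in a finite alphabet, read as numbers with the most significant digit first. -/
noncomputable def wordCode : List β → ℕ
  | [] => 0
  | a :: l => (Fintype.equivFin β a : ℕ) * Fintype.card β ^ l.length + wordCode l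

theorem wordCode_append (l m : List β) :
    wordCode (l ++ m) = wordCode l * Fintype.card β ^ m.length + wordCode m := by
  induction l with
  | nil => simp [wordCode]
  | cons a l ih => simp only [List.cons_append, wordCode, ih, List.length_append]; ring

theorem wordCode_lt (l : List β) : wordCode l < Fintype.card β ^ l.length := by
  induction l with
  | nil => simp [wordCode]
  | cons a l ih =>
    have h : (Fintype.equivFin β a : ℕ) + 1 ≤ Fintype.card β := (Fintype.equivFin β a).2
    simp only [wordCode, List.length_cons, pow_succ']
    nlinarith [Nat.mul_le_mul_right (Fintype.card β ^ l.length) h]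

theorem wordCode_injective_of_length_eq {l m : List β} (h : l.length = m.length)
    (hc : wordCode l = wordCode m) : l = m := by
  induction l generalizing m with
  | nil => exact (List.length_eq_zero_iff.1 h.symm).symm
  | cons a l ih =>
    cases m with
    | nil => simp at h
    | cons b m =>
      have h' : l.length = m.length := by simpa using h
      simp only [wordCode, h'] at hc
      have hl := wordCode_lt l
      have hm := wordCode_lt m
      rw [h'] at hl
      have hpos : 0 < Fintype.card β ^ m.length := by omega
      have e1 := congrArg (· / Fintype.card β ^ m.length) hc
      have e2 := congrArg (· % Fintype.card β ^ m.length) hc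
      simp only [mul_comm _ (Fintype.card β ^ m.length), Nat.mul_add_div hpos,
        Nat.div_eq_of_lt hl, Nat.div_eq_of_lt hm, add_zero] at e1
      simp only [mul_comm _ (Fintype.card β ^ m.length), Nat.mul_add_mod,
        Nat.mod_eq_of_lt hl, Nat.mod_eq_of_lt hm] at e2
      rw [ih h' e2, (Fintype.equivFin β).injective (Fin.ext e1)]

end Code

/-! ### Cancellation in free groups and Nielsen reduced families -/

section Cancellation

variable {α : Type*} [DecidableEq α]

/-- The number of letters that cancel in the product `x⁻¹ * y`. -/
def cancel (x y : FreeGroup α) : ℕ := commonPrefixLength x.toWord y.toWord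

theorem cancel_comm (x y : FreeGroup α) : cancel x y = cancel y x :=
  commonPrefixLength_comm _ _

theorem isReduced_invRev {l : List (α × Bool)} (h : FreeGroup.IsReduced l) :
    FreeGroup.IsReduced (FreeGroup.invRev l) := by
  rw [FreeGroup.isReduced_iff_reduce_eq, FreeGroup.reduce_invRev, h.reduce_eq]

theorem norm_mk_of_isReduced {l : List (α × Bool)} (h : FreeGroup.IsReduced l) :
    (FreeGroup.mk l).norm = l.length := by
  rw [FreeGroup.norm, FreeGroup.toWord_mk, h.reduce_eq]

/-- Equal first letters cancel in pairs; once the first letters differ, the concatenation of the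
inverse of `l` with `m` is already reduced. -/
theorem norm_inv_mk_mul_mk {l m : List (α × Bool)} (hl : FreeGroup.IsReduced l)
    (hm : FreeGroup.IsReduced m) :
    ((FreeGroup.mk l)⁻¹ * FreeGroup.mk m).norm + 2 * commonPrefixLength l m =
      l.length + m.length := by
  induction l generalizing m with
  | nil =>
    rw [← FreeGroup.one_eq_mk]
    simp [commonPrefixLength, norm_mk_of_isReduced hm]
  | cons a l ih =>
    cases m with
    | nil =>
      rw [← FreeGroup.one_eq_mk, mul_one, FreeGroup.norm_inv_eq, norm_mk_of_isReduced hl]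
      simp [commonPrefixLength]
    | cons b m =>
      by_cases h : a = b
      · subst h
        have h1 := ih (m := m) (hl.infix ⟨[a], [], by simp⟩) (hm.infix ⟨[a], [], by simp⟩)
        have h2 : (FreeGroup.mk (a :: l))⁻¹ * FreeGroup.mk (a :: m) =
            (FreeGroup.mk l)⁻¹ * FreeGroup.mk m := by
          have h3 : ∀ k, FreeGroup.mk (a :: k) = FreeGroup.mk [a] * FreeGroup.mk k :=
            fun k => by rw [FreeGroup.mul_mk, List.singleton_append]
          rw [h3 l, h3 m]
          group
        rw [h2]
        simp only [commonPrefixLength, if_true, List.length_cons]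
        omega
      · have h1 : FreeGroup.IsReduced (FreeGroup.invRev (a :: l) ++ b :: m) := by
          have h2 := isReduced_invRev hl
          rw [FreeGroup.invRev_cons] at h2 ⊢
          have h3 : FreeGroup.IsReduced (FreeGroup.invRev [a] ++ b :: m) := by
            simp only [FreeGroup.invRev, List.map_cons, List.map_nil, List.reverse_singleton,
              List.singleton_append, FreeGroup.isReduced_cons_cons]
            refine ⟨fun h4 => ?_, hm⟩
            by_contra h5
            apply h
            refine Prod.ext h4 ?_
            revert h5
            cases a.2 <;> cases b.2 <;> simp
          exact FreeGroup.IsReduced.append_overlap h2 h3 (by simp [FreeGroup.invRev])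
        rw [FreeGroup.inv_mk, FreeGroup.mul_mk, norm_mk_of_isReduced h1]
        simp [commonPrefixLength, h]

theorem norm_inv_mul_add (x y : FreeGroup α) :
    (x⁻¹ * y).norm + 2 * cancel x y = x.norm + y.norm := by
  have := norm_inv_mk_mul_mk (FreeGroup.isReduced_toWord (x := x))
    (FreeGroup.isReduced_toWord (x := y))
  rwa [FreeGroup.mk_toWord, FreeGroup.mk_toWord] at this

theorem norm_mul_add (x y : FreeGroup α) :
    (x * y).norm + 2 * cancel x⁻¹ y = x.norm + y.norm := by
  simpa [FreeGroup.norm_inv_eq] using norm_inv_mul_add x⁻¹ y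

theorem cancel_self (x : FreeGroup α) : cancel x x = x.norm := by
  have := norm_inv_mul_add x x
  simp at this
  omega

theorem cancel_eq_of_lt {x y z : FreeGroup α} (h : cancel x y < cancel z y) :
    cancel x z = cancel x y :=
  commonPrefixLength_eq_of_lt h

theorem take_eq_take_of_le_cancel {x y : FreeGroup α} {k : ℕ} (h : k ≤ cancel x y) :
    x.toWord.take k = y.toWord.take k :=
  ((le_commonPrefixLength_iff _ _ _).1 h).2.2

/-- Less than half of a word cancels in its square. -/
theorem two_mul_cancel_inv_self_lt {x : FreeGroup α} (hx : x ≠ 1) :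
    2 * cancel x⁻¹ x < x.norm := by
  by_contra hcon
  push Not at hcon
  have hpos : x.norm ≠ 0 := fun h => hx (FreeGroup.norm_eq_zero.1 h)
  set l := x.toWord with hl
  have hred : FreeGroup.IsReduced l := FreeGroup.isReduced_toWord
  have hnorm : x.norm = l.length := rfl
  have htake := take_eq_take_of_le_cancel (le_refl (cancel x⁻¹ x))
  rw [FreeGroup.toWord_inv, ← hl] at htake
  have key : ∀ i, i < cancel x⁻¹ x → ∀ hi : i < l.length,
      l[i] = (l[l.length - 1 - i].1, !l[l.length - 1 - i].2) := by
    intro i hi hil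
    have h1 := congrArg (fun m => m[i]?) htake
    simp only [List.getElem?_take, hi, if_true] at h1
    rw [List.getElem?_eq_getElem hil, List.getElem?_eq_getElem (by simpa using hil)] at h1
    have h2 := Option.some.inj h1
    rw [← h2]
    simp [FreeGroup.invRev]
  -- The antisymmetry `key` reaches the middle of the word: for even length the two middle letters
  -- would cancel, for odd length the middle letter would be its own inverse.
  rcases Nat.even_or_odd' l.length with ⟨k, hk | hk⟩
  · have h1 := key (k - 1) (by omega) (by omega)
    have h2 := List.isChain_iff_getElem.1 hred (k - 1) (by omega)
    have h3 : l.length - 1 - (k - 1) = k - 1 + 1 := by omega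
    simp only [h3] at h1
    rw [h1] at h2
    have h4 := h2 rfl
    revert h4
    generalize (l[k - 1 + 1]'(by omega)).2 = b
    cases b <;> simp
  · have h1 := key k (by omega) (by omega)
    have h3 : l.length - 1 - k = k := by omega
    simp only [h3] at h1
    have h4 := congrArg Prod.snd h1
    revert h4
    simp only
    generalize (l[k]'(by omega)).2 = b
    cases b <;> simp

theorem toWord_eq_of_length_eq_norm {x : FreeGroup α} {l : List (α × Bool)}
    (h : FreeGroup.mk l = x) (hl : l.length = x.norm) : x.toWord = l := by
  subst h
  rw [FreeGroup.toWord_mk]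
  refine (FreeGroup.reduce.red (L := l)).sublist.eq_of_length ?_
  rw [hl, FreeGroup.norm, FreeGroup.toWord_mk]

/-- Letters which do not cancel when they are adjacent in a word. -/
abbrev Compatible (a b : α × Bool) : Prop := a.1 = b.1 → a.2 = b.2

/-- In a Nielsen reduced family every reduced product is at least as long as the number of its
factors. -/
theorem length_le_norm_prod_of_reduced (f : α × Bool → FreeGroup α) (hone : ∀ a, f a ≠ 1)
    (h2 : ∀ a b, Compatible a b → 2 * cancel (f a)⁻¹ (f b) ≤ (f b).norm)
    (h3 : ∀ a b c, Compatible a b → Compatible b c →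
      cancel (f a)⁻¹ (f b) + cancel (f b)⁻¹ (f c) < (f b).norm)
    (l : List (α × Bool)) (hl : FreeGroup.IsReduced l) : l.length ≤ (l.map f).prod.norm := by
  -- Strengthened for induction from the right: the product still begins with more of `f b` than a
  -- preceding factor can cancel, and its length has enough slack to absorb that cancellation.
  have key : ∀ (l : List (α × Bool)) (b : α × Bool), FreeGroup.IsReduced (b :: l) →
      ∀ a, Compatible a b →
        cancel (f a)⁻¹ (f b) < cancel ((b :: l).map f).prod (f b) ∧
        (b :: l).length + cancel (f a)⁻¹ (f b) ≤ ((b :: l).map f).prod.norm := by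
    intro l
    induction l with
    | nil =>
      intro b _ a hab
      have hpos : (f b).norm ≠ 0 := fun h => hone b (FreeGroup.norm_eq_zero.1 h)
      have := h2 a b hab
      simp only [List.map_cons, List.map_nil, List.prod_cons, List.prod_nil, mul_one,
        cancel_self, List.length_cons, List.length_nil]
      omega
    | cons c l ih =>
      intro b hred a hab
      rw [FreeGroup.isReduced_cons_cons] at hred
      obtain ⟨ih1, ih2⟩ := ih c hred.2 b hred.1
      rw [List.map_cons, List.prod_cons]
      generalize hw : ((c :: l).map f).prod = w at ih1 ih2 ⊢
      have e1 := cancel_eq_of_lt ih1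
      have e2 := norm_mul_add (f b) w
      have e3 := norm_inv_mul_add (f b * w) (f b)
      have e4 : ((f b * w)⁻¹ * f b).norm = w.norm := by
        rw [← FreeGroup.norm_inv_eq (x := w)]
        congr 1
        group
      have e5 := h3 a b c hab hred.1
      rw [List.length_cons] at ih2 ⊢
      rw [List.length_cons]
      omega
  cases l with
  | nil => simp
  | cons b l =>
    have := (key l b hl b fun _ => rfl).2
    omega

end Cancellation

/-! ### The tie-break between words of equal length -/

section HalfWord

variable {α : Type*} [DecidableEq α] [Fintype α]

/-- The initial half of a reduced word, with the middle letter if there is one. -/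
def initialHalf (x : FreeGroup α) : List (α × Bool) := x.toWord.take ((x.norm + 1) / 2)

/-- The sum of the codes of the initial halves of `x` and `x⁻¹`. -/
noncomputable def halfCode (x : FreeGroup α) : ℕ :=
  wordCode (initialHalf x) + wordCode (initialHalf x⁻¹)

theorem halfCode_inv (x : FreeGroup α) : halfCode x⁻¹ = halfCode x := by
  rw [halfCode, halfCode, inv_inv, add_comm]

theorem halfCode_mul_lt {y z : FreeGroup α} (h1 : 2 * cancel y⁻¹ z = y.norm)
    (h2 : 2 * cancel y⁻¹ z ≤ z.norm)
    (h3 : wordCode (y.toWord.take (y.norm / 2)) < wordCode (y⁻¹.toWord.take (y.norm / 2))) :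
    (y * z).norm = z.norm ∧ halfCode (y * z) < halfCode z := by
  have hn : (y * z).norm = z.norm := by
    have := norm_mul_add y z
    omega
  refine ⟨hn, ?_⟩
  generalize hk : cancel y⁻¹ z = k at h1 h2
  have hk2 : y.norm / 2 = k := by omega
  rw [hk2] at h3
  have hqz := take_eq_take_of_le_cancel (le_of_eq hk.symm)
  generalize hp : y.toWord.take k = p at h3
  generalize hq : y⁻¹.toWord.take k = q at h3 hqz
  have hly : y.toWord.length = 2 * k := h1.symm
  have hlz : z.toWord.length = z.norm := rfl
  have hlp : p.length = k := by rw [← hp, List.length_take]; omega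
  have hlq : q.length = k := by
    rw [← hq, List.length_take, FreeGroup.toWord_inv, FreeGroup.invRev_length]; omega
  obtain ⟨c, hc⟩ : ∃ c, z.toWord = q ++ c := ⟨z.toWord.drop k, by rw [hqz, List.take_append_drop]⟩
  have hlc : k + c.length = z.norm := by rw [← hlz, hc, List.length_append, hlq]
  have hy : y.toWord = p ++ FreeGroup.invRev q := by
    have hr : y.toWord = FreeGroup.invRev (y⁻¹.toWord.drop k) ++ FreeGroup.invRev q := by
      rw [← hq, ← FreeGroup.invRev_append, List.take_append_drop, FreeGroup.toWord_inv,
        FreeGroup.invRev_invRev]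
    have hlr : (FreeGroup.invRev (y⁻¹.toWord.drop k)).length = k := by
      rw [FreeGroup.invRev_length, List.length_drop, FreeGroup.toWord_inv,
        FreeGroup.invRev_length]
      omega
    have hpr : p = FreeGroup.invRev (y⁻¹.toWord.drop k) := by
      rw [← hp, hr, List.take_append_of_le_length hlr.ge, List.take_of_length_le hlr.le]
    rw [hpr, ← hr]
  have hyz : (y * z).toWord = p ++ c := by
    refine toWord_eq_of_length_eq_norm ?_ (by rw [List.length_append, hlp, hn, hlc])
    rw [← FreeGroup.mk_toWord (x := y), ← FreeGroup.mk_toWord (x := z), hy, hc,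
      ← FreeGroup.mul_mk, ← FreeGroup.mul_mk, ← FreeGroup.mul_mk, ← FreeGroup.inv_mk]
    group
  have hm : k ≤ (z.norm + 1) / 2 := by omega
  have i1 : initialHalf (y * z) = p ++ c.take ((z.norm + 1) / 2 - k) := by
    rw [initialHalf, hn, hyz, List.take_append, hlp, List.take_of_length_le (by omega)]
  have i2 : initialHalf z = q ++ c.take ((z.norm + 1) / 2 - k) := by
    rw [initialHalf, hc, List.take_append, hlq, List.take_of_length_le (by omega)]
  -- Since q is at most half of z, the initial half of z⁻¹ lies inside c⁻¹ and is not affected.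
  have i3 : initialHalf (y * z)⁻¹ = initialHalf z⁻¹ := by
    rw [initialHalf, initialHalf, FreeGroup.norm_inv_eq, FreeGroup.norm_inv_eq, hn,
      FreeGroup.toWord_inv, FreeGroup.toWord_inv, hyz, hc, FreeGroup.invRev_append,
      FreeGroup.invRev_append, List.take_append_of_le_length, List.take_append_of_le_length]
    all_goals rw [FreeGroup.invRev_length]; omega
  rw [halfCode, halfCode, i3, i1, i2, wordCode_append, wordCode_append]
  have hpos : 0 < Fintype.card (α × Bool) ^ (c.take ((z.norm + 1) / 2 - k)).length :=
    lt_of_le_of_lt (Nat.zero_le _) (wordCode_lt (c.take ((z.norm + 1) / 2 - k)))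
  have := Nat.mul_lt_mul_of_pos_right h3 hpos
  omega

end HalfWord

/-! ### Nielsen's generation theorem -/

section Nielsen

variable {n : ℕ}

/-- The automorphism `a_i ↦ a_{σ i}`. -/
def permAut : Equiv.Perm (Fin n) →* MulAut (FreeGroup (Fin n)) where
  toFun σ := FreeGroup.freeGroupCongr σ
  map_one' := FreeGroup.freeGroupCongr_refl
  map_mul' σ τ := (FreeGroup.freeGroupCongr_trans τ σ).symm

@[simp] theorem permAut_of (σ : Equiv.Perm (Fin n)) (k : Fin n) :
    permAut σ (FreeGroup.of k) = FreeGroup.of (σ k) := by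
  simp [permAut]

theorem epsAut_of (i k : Fin n) :
    epsAut i (FreeGroup.of k) = if k = i then (FreeGroup.of k)⁻¹ else FreeGroup.of k := by
  simp [epsAut, epsHom]

@[simp] theorem epsAut_of_self (i : Fin n) :
    epsAut i (FreeGroup.of i) = (FreeGroup.of i)⁻¹ := by
  simp [epsAut_of]

theorem epsAut_of_ne {i k : Fin n} (h : k ≠ i) :
    epsAut i (FreeGroup.of k) = FreeGroup.of k := by
  simp [epsAut_of, h]

theorem rhoAut_of (i j k : Fin n) (h : i ≠ j) :
    rhoAut i j h (FreeGroup.of k) =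
      if k = i then FreeGroup.of k * FreeGroup.of j else FreeGroup.of k := by
  simp [rhoAut, transvHom]

@[simp] theorem rhoAut_of_self (i j : Fin n) (h : i ≠ j) :
    rhoAut i j h (FreeGroup.of i) = FreeGroup.of i * FreeGroup.of j := by
  simp [rhoAut_of]

theorem rhoAut_of_ne {i j k : Fin n} (h : i ≠ j) (hk : k ≠ i) :
    rhoAut i j h (FreeGroup.of k) = FreeGroup.of k := by
  simp [rhoAut_of, hk]

theorem mulAut_ext {f g : MulAut (FreeGroup (Fin n))}
    (h : ∀ k, f (FreeGroup.of k) = g (FreeGroup.of k)) : f = g := by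
  have : f.toMonoidHom = g.toMonoidHom := FreeGroup.ext_hom _ _ h
  exact MulEquiv.toMonoidHom_injective this

theorem mk_singleton_eq (a : Fin n × Bool) :
    FreeGroup.mk [a] = FreeGroup.of a.1 ∨ FreeGroup.mk [a] = (FreeGroup.of a.1)⁻¹ := by
  obtain ⟨i, b⟩ := a
  cases b
  · right; rfl
  · left; rfl

theorem mk_singleton_not (a : Fin n × Bool) :
    FreeGroup.mk [(a.1, !a.2)] = (FreeGroup.mk [a])⁻¹ := by
  simp [FreeGroup.inv_mk, FreeGroup.invRev]

theorem of_ne_of_inv (i j : Fin n) : FreeGroup.of i ≠ (FreeGroup.of j)⁻¹ := by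
  intro h
  have := congrArg FreeGroup.toWord h
  simp [FreeGroup.toWord_inv, FreeGroup.invRev] at this

section Subgroup

variable {H : Subgroup (MulAut (FreeGroup (Fin n)))}

theorem sign_mem (hε : ∀ i, epsAut i ∈ H) (g : MulAut (FreeGroup (Fin n)))
    (hg : ∀ k, g (FreeGroup.of k) = FreeGroup.of k ∨ g (FreeGroup.of k) = (FreeGroup.of k)⁻¹) :
    g ∈ H := by
  suffices h : ∀ s : Finset (Fin n), ∀ g : MulAut (FreeGroup (Fin n)),
      (∀ k, g (FreeGroup.of k) = FreeGroup.of k ∨ g (FreeGroup.of k) = (FreeGroup.of k)⁻¹) →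
      (∀ k, k ∉ s → g (FreeGroup.of k) = FreeGroup.of k) → g ∈ H from
    h Finset.univ g hg (by simp)
  intro s
  induction s using Finset.induction_on with
  | empty =>
    intro g _ h
    have : g = 1 := mulAut_ext fun k => by simpa using h k (by simp)
    rw [this]
    exact H.one_mem
  | insert i s _ ih =>
    intro g hg h
    rcases hg i with hi | hi
    · refine ih g hg fun k hk => ?_
      by_cases hki : k = i
      · rw [hki, hi]
      · exact h k (by simp [hki, hk])
    · have : g * epsAut i ∈ H := by
        refine ih _ (fun k => ?_) (fun k hk => ?_)
        · by_cases hki : k = i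
          · left; simp [hki, hi]
          · simpa [epsAut_of_ne hki] using hg k
        · by_cases hki : k = i
          · simp [hki, hi]
          · simpa [epsAut_of_ne hki] using h k (by simp [hki, hk])
      exact (H.mul_mem_cancel_right (hε i)).1 this

/-- Right transvections together with sign changes give multiplication by any letter on the left.
The inverse and the stray signs are harmless, as length and half-word code are invariant under
inversion. -/
theorem exists_mem_of_eq_inv_mul (hε : ∀ i, epsAut i ∈ H) (hρ : ∀ i j h, rhoAut i j h ∈ H)
    {a b : Fin n × Bool} (hab : a.1 ≠ b.1) :
    ∃ h ∈ H, h (FreeGroup.of b.1) = (FreeGroup.mk [a] * FreeGroup.mk [b])⁻¹ ∧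
      ∀ k, k ≠ b.1 → h (FreeGroup.of k) = FreeGroup.of k ∨
        h (FreeGroup.of k) = (FreeGroup.of k)⁻¹ := by
  have sgn : ∀ c : Fin n × Bool, ∃ s ∈ H, s (FreeGroup.of c.1) = (FreeGroup.mk [c])⁻¹ ∧
      ∀ k, k ≠ c.1 → s (FreeGroup.of k) = FreeGroup.of k := by
    intro c
    rcases mk_singleton_eq c with h | h
    · exact ⟨epsAut c.1, hε _, by simp [h], fun k hk => epsAut_of_ne hk⟩
    · exact ⟨1, H.one_mem, by simp [h], fun k _ => rfl⟩
  obtain ⟨s, hs, hs1, hs2⟩ := sgn a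
  obtain ⟨s', hs', hs1', hs2'⟩ := sgn b
  have sb : s' (FreeGroup.mk [a]) = FreeGroup.mk [a] := by
    rcases mk_singleton_eq a with h | h <;> simp [h, hs2' _ hab]
  refine ⟨s' * s * rhoAut b.1 a.1 hab.symm, H.mul_mem (H.mul_mem hs' hs) (hρ _ _ _), ?_, ?_⟩
  · rw [MulAut.mul_apply, MulAut.mul_apply, rhoAut_of_self, map_mul, hs2 _ hab.symm, hs1, map_mul,
      hs1', map_inv, sb, mul_inv_rev]
  · intro k hk
    simp only [MulAut.mul_apply, rhoAut_of_ne _ hk]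
    by_cases hka : k = a.1
    · rw [hka, hs1, map_inv, sb]
      rcases mk_singleton_eq a with h | h <;> simp [h]
    · left
      rw [hs2 _ hka, hs2' _ hk]

/-- Total length and total half-word code of the images of the generators. -/
noncomputable def complexity (ψ : MulAut (FreeGroup (Fin n))) : ℕ ×ₗ ℕ :=
  toLex (∑ i, (ψ (FreeGroup.of i)).norm, ∑ i, halfCode (ψ (FreeGroup.of i)))

theorem exists_complexity_minimal (g : MulAut (FreeGroup (Fin n))) :
    ∃ k ∈ H, ∀ h ∈ H, ¬ complexity (g * k * h) < complexity (g * k) := by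
  obtain ⟨k, hk, hmin⟩ := (InvImage.wf (fun k => complexity (g * k))
    (wellFounded_lt (α := ℕ ×ₗ ℕ))).has_min (H : Set _) ⟨1, H.one_mem⟩
  exact ⟨k, hk, fun h hh => by simpa [mul_assoc, InvImage] using hmin (k * h) (H.mul_mem hk hh)⟩

section Minimal

variable {ψ : MulAut (FreeGroup (Fin n))}

theorem norm_le_and_halfCode_le (hε : ∀ i, epsAut i ∈ H) (hρ : ∀ i j h, rhoAut i j h ∈ H)
    (hmin : ∀ h ∈ H, ¬ complexity (ψ * h) < complexity ψ)
    {a b : Fin n × Bool} (hab : a.1 ≠ b.1) :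
    (ψ (FreeGroup.mk [b])).norm ≤ (ψ (FreeGroup.mk [a]) * ψ (FreeGroup.mk [b])).norm ∧
    ((ψ (FreeGroup.mk [a]) * ψ (FreeGroup.mk [b])).norm = (ψ (FreeGroup.mk [b])).norm →
      halfCode (ψ (FreeGroup.mk [b])) ≤ halfCode (ψ (FreeGroup.mk [a]) * ψ (FreeGroup.mk [b]))) := by
  obtain ⟨h, hh, h1, h2⟩ := exists_mem_of_eq_inv_mul hε hρ hab
  have key : ∀ m : FreeGroup (Fin n) → ℕ, (∀ x, m x⁻¹ = m x) →
      (∑ i, m ((ψ * h) (FreeGroup.of i))) + m (ψ (FreeGroup.mk [b])) =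
      (∑ i, m (ψ (FreeGroup.of i))) + m (ψ (FreeGroup.mk [a]) * ψ (FreeGroup.mk [b])) := by
    intro m hm
    rw [← Finset.add_sum_erase _ _ (Finset.mem_univ b.1),
      ← Finset.add_sum_erase Finset.univ (fun i => m (ψ (FreeGroup.of i))) (Finset.mem_univ b.1)]
    have e1 : m ((ψ * h) (FreeGroup.of b.1)) =
        m (ψ (FreeGroup.mk [a]) * ψ (FreeGroup.mk [b])) := by
      rw [MulAut.mul_apply, h1, map_inv, hm, map_mul]
    have e2 : m (ψ (FreeGroup.of b.1)) = m (ψ (FreeGroup.mk [b])) := by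
      rcases mk_singleton_eq b with hb | hb <;> simp [hb, hm]
    have e3 : ∑ i ∈ Finset.univ.erase b.1, m ((ψ * h) (FreeGroup.of i)) =
        ∑ i ∈ Finset.univ.erase b.1, m (ψ (FreeGroup.of i)) := by
      refine Finset.sum_congr rfl fun i hi => ?_
      rcases h2 i (Finset.ne_of_mem_erase hi) with h3 | h3 <;> simp [h3, hm]
    rw [e1, e2, e3]
    ring
  have k1 := key FreeGroup.norm fun x => FreeGroup.norm_inv_eq
  have k2 := key halfCode halfCode_inv
  have hlt := hmin h hh
  simp only [complexity, Prod.Lex.toLex_lt_toLex, not_or, not_and] at hlt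
  omega

/-- Minimality of total length says that at most half of a factor cancels against a neighbour;
minimality of the code excludes that both halves of a factor cancel. These are the hypotheses of
`length_le_norm_prod_of_reduced`. -/
theorem isReduced_of_minimal (hε : ∀ i, epsAut i ∈ H) (hρ : ∀ i j h, rhoAut i j h ∈ H)
    (hmin : ∀ h ∈ H, ¬ complexity (ψ * h) < complexity ψ)
    (l : List (Fin n × Bool)) (hl : FreeGroup.IsReduced l) :
    l.length ≤ (ψ (FreeGroup.mk l)).norm := by
  set f : Fin n × Bool → FreeGroup (Fin n) := fun a => ψ (FreeGroup.mk [a]) with hf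
  have hone : ∀ a, f a ≠ 1 := by
    intro a h
    rw [hf, MulEquiv.map_eq_one_iff] at h
    rcases mk_singleton_eq a with h' | h' <;> simp [h'] at h
  have hinv : ∀ a, f (a.1, !a.2) = (f a)⁻¹ := fun a => by
    simp only [hf, mk_singleton_not, map_inv]
  have hsq : ∀ a b, a.1 = b.1 → Compatible a b → 2 * cancel (f a)⁻¹ (f b) < (f b).norm := by
    intro a b h h'
    have : a = b := Prod.ext h (h' h)
    subst this
    exact two_mul_cancel_inv_self_lt (hone a)
  have hN1 : ∀ a b, Compatible a b → 2 * cancel (f a)⁻¹ (f b) ≤ (f b).norm := by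
    intro a b hab
    by_cases h : a.1 = b.1
    · exact (hsq a b h hab).le
    · have h1 := (norm_le_and_halfCode_le hε hρ hmin (a := (b.1, !b.2)) (b := (a.1, !a.2))
        (Ne.symm h)).1
      have h2 := norm_mul_add (f (b.1, !b.2)) (f (a.1, !a.2))
      rw [hinv, hinv, inv_inv, cancel_comm, FreeGroup.norm_inv_eq] at h2
      change (f (a.1, !a.2)).norm ≤ (f (b.1, !b.2) * f (a.1, !a.2)).norm at h1
      rw [hinv, hinv] at h1
      omega
  have hN1' : ∀ a b, Compatible a b → 2 * cancel (f a)⁻¹ (f b) ≤ (f a).norm := by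
    intro a b hab
    have h1 := hN1 (b.1, !b.2) (a.1, !a.2) fun h => by
      simp only [Bool.not_inj_iff]
      exact (hab h.symm).symm
    rwa [hinv, hinv, inv_inv, cancel_comm, FreeGroup.norm_inv_eq] at h1
  have htie : ∀ b c, b.1 ≠ c.1 → 2 * cancel (f b)⁻¹ (f c) = (f b).norm →
      ¬ wordCode ((f b).toWord.take ((f b).norm / 2)) <
        wordCode ((f b)⁻¹.toWord.take ((f b).norm / 2)) := by
    intro b c hbc h1 h2
    obtain ⟨h3, h4⟩ := halfCode_mul_lt h1 (hN1 b c fun h => absurd h hbc) h2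
    exact absurd h4 (not_lt.2 ((norm_le_and_halfCode_le hε hρ hmin hbc).2 h3))
  -- Otherwise exactly half of `f b` cancels on each side. The tie-break on both sides gives
  -- opposite inequalities, so `f b` and its inverse share their initial halves, and half of `f b`
  -- would cancel in its square.
  have hN2 : ∀ a b c, Compatible a b → Compatible b c →
      cancel (f a)⁻¹ (f b) + cancel (f b)⁻¹ (f c) < (f b).norm := by
    intro a b c hab hbc
    by_contra hcon
    have h1 := hN1 a b hab
    have h2 := hN1' b c hbc
    have hab' : a.1 ≠ b.1 := fun h => by have := hsq a b h hab; omega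
    have hbc' : b.1 ≠ c.1 := fun h => by
      have h3 := hsq b c h hbc
      have : b = c := Prod.ext h (hbc h)
      rw [← this] at h3 hcon
      omega
    have e1 : 2 * cancel (f b)⁻¹ (f c) = (f b).norm := by omega
    have e2 : 2 * cancel (f (b.1, !b.2))⁻¹ (f (a.1, !a.2)) = (f (b.1, !b.2)).norm := by
      rw [hinv, hinv, inv_inv, cancel_comm, FreeGroup.norm_inv_eq]
      omega
    have t1 := htie b c hbc' e1
    have t2 := htie (b.1, !b.2) (a.1, !a.2) (Ne.symm hab') e2
    rw [hinv, inv_inv, FreeGroup.norm_inv_eq] at t2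
    have hlen : ((f b).norm / 2) ≤ (f b).toWord.length := Nat.div_le_self _ _
    have hlen' : ((f b).norm / 2) ≤ (f b)⁻¹.toWord.length := by
      rw [FreeGroup.toWord_inv, FreeGroup.invRev_length]
      exact hlen
    have t3 := wordCode_injective_of_length_eq (by
      rw [List.length_take_of_le hlen, List.length_take_of_le hlen'])
      (le_antisymm (not_lt.1 t2) (not_lt.1 t1))
    have t4 : (f b).norm / 2 ≤ cancel (f b)⁻¹ (f b) :=
      (le_commonPrefixLength_iff _ _ _).2 ⟨hlen', hlen, t3.symm⟩
    have t5 := two_mul_cancel_inv_self_lt (hone b)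
    omega
  have hprod : ∀ l : List (Fin n × Bool), ψ (FreeGroup.mk l) = (l.map f).prod := by
    intro l
    induction l with
    | nil => rw [← FreeGroup.one_eq_mk]; simp
    | cons a l ih =>
      rw [← List.singleton_append, ← FreeGroup.mul_mk, map_mul, ih]
      simp [hf]
  rw [hprod]
  exact length_le_norm_prod_of_reduced f hone hN1 hN2 l hl

end Minimal

/-- Nielsen's theorem: the automorphism group of a free group of finite rank is generated by
sign changes, permutations of the generators and transvections. -/
theorem subgroup_eq_top (hε : ∀ i, epsAut i ∈ H) (hσ : ∀ σ, permAut σ ∈ H)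
    (hρ : ∀ i j h, rhoAut i j h ∈ H) : H = ⊤ := by
  rw [eq_top_iff]
  intro g _
  obtain ⟨k, hk, hmin⟩ := exists_complexity_minimal (H := H) g
  generalize hψ : g * k = ψ at hmin
  -- The preimage of a generator is no longer than its image under `ψ`, which has length 1.
  have hgen : ∀ i, ∃ c : Fin n × Bool, ψ⁻¹ (FreeGroup.of i) = FreeGroup.mk [c] := by
    intro i
    have h1 := isReduced_of_minimal hε hρ hmin (ψ⁻¹ (FreeGroup.of i)).toWord
      FreeGroup.isReduced_toWord
    rw [FreeGroup.mk_toWord, MulAut.apply_inv_self, FreeGroup.norm_of] at h1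
    have h2 : (ψ⁻¹ (FreeGroup.of i)).toWord.length ≠ 0 := by
      rw [Ne, List.length_eq_zero_iff, FreeGroup.toWord_eq_nil_iff, MulEquiv.map_eq_one_iff]
      exact FreeGroup.of_ne_one i
    obtain ⟨c, hc⟩ := List.length_eq_one_iff.1
      (show (ψ⁻¹ (FreeGroup.of i)).toWord.length = 1 by omega)
    exact ⟨c, by rw [← hc, FreeGroup.mk_toWord]⟩
  choose c hc using hgen
  have hinj : Function.Injective fun i => (c i).1 := by
    intro i j hij
    have hij : (c i).1 = (c j).1 := hij
    have hcases : ψ⁻¹ (FreeGroup.of i) = ψ⁻¹ (FreeGroup.of j) ∨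
        ψ⁻¹ (FreeGroup.of i) = ψ⁻¹ (FreeGroup.of j)⁻¹ := by
      rw [map_inv, hc, hc]
      rcases mk_singleton_eq (c i) with h | h <;> rcases mk_singleton_eq (c j) with h' | h' <;>
        simp [h, h', hij]
    rcases hcases with h | h
    · exact FreeGroup.of_injective ((ψ⁻¹).injective h)
    · exact absurd ((ψ⁻¹).injective h) (of_ne_of_inv i j)
  let σ : Equiv.Perm (Fin n) := Equiv.ofBijective _ (Finite.injective_iff_bijective.1 hinj)
  have hmem : (permAut σ)⁻¹ * ψ⁻¹ ∈ H := by
    refine sign_mem hε _ fun i => ?_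
    rw [MulAut.mul_apply, hc]
    have : (permAut σ)⁻¹ (FreeGroup.of (c i).1) = FreeGroup.of i := by
      rw [← map_inv, permAut_of]
      exact congrArg _ (σ.symm_apply_apply i)
    rcases mk_singleton_eq (c i) with h | h
    · left; rw [h, this]
    · right; rw [h, map_inv ((permAut σ)⁻¹), this]
  have hψ' : ψ ∈ H := by
    have := (H.mul_mem_cancel_left (H.inv_mem (hσ σ))).1 hmem
    exact H.inv_mem_iff.1 this
  rw [← hψ] at hψ'
  exact (H.mul_mem_cancel_right hk).1 hψ'

end Subgroup

end Nielsen

/-- `σ ρ_{ij} σ⁻¹ = ρ_{σ i, σ j}`. -/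
theorem permAut_mul_rhoAut {n : ℕ} (σ : Equiv.Perm (Fin n)) (i j : Fin n) (h : i ≠ j) :
    permAut σ * rhoAut i j h = rhoAut (σ i) (σ j) (σ.injective.ne h) * permAut σ := by
  refine mulAut_ext fun k => ?_
  by_cases hk : k = i
  · simp [hk]
  · simp [rhoAut_of_ne h hk, rhoAut_of_ne _ (σ.injective.ne hk)]

theorem permAut_mul_epsAut {n : ℕ} (σ : Equiv.Perm (Fin n)) (i : Fin n) :
    permAut σ * epsAut i = epsAut (σ i) * permAut σ := by
  refine mulAut_ext fun k => ?_
  by_cases hk : k = i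
  · simp [hk]
  · simp [epsAut_of_ne hk, epsAut_of_ne (σ.injective.ne hk)]

theorem epsAut_mul_self {n : ℕ} (i : Fin n) : epsAut i * epsAut i = 1 := by
  refine mulAut_ext fun k => ?_
  by_cases hk : k = i
  · simp [hk]
  · simp [epsAut_of_ne hk]

theorem epsAut_mul_comm {n : ℕ} (i j : Fin n) : epsAut i * epsAut j = epsAut j * epsAut i := by
  refine mulAut_ext fun k => ?_
  simp only [MulAut.mul_apply, epsAut_of]
  split_ifs <;> simp_all [epsAut_of]

/-- Automorphisms that agree up to conjugation by `u` on the generators have the same class. -/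
theorem mk_eq_mk_of_conj {n : ℕ} (f g : MulAut (FreeGroup (Fin n))) (u : FreeGroup (Fin n))
    (h : ∀ k, f (FreeGroup.of k) = u * g (FreeGroup.of k) * u⁻¹) :
    (QuotientGroup.mk f : Out n) = QuotientGroup.mk g := by
  have : f = MulAut.conj u * g := mulAut_ext fun k => by simp [h]
  rw [this]
  refine (QuotientGroup.eq).2 ?_
  have h2 := (innNormal (FreeGroup (Fin n))).conj_mem _
    ((MulAut.conj (G := FreeGroup (Fin n))).range.inv_mem ⟨u, rfl⟩) g⁻¹
  simpa [mul_assoc] using h2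

/-! ### Relations of Out(F_3) -/

section Rank3

theorem epsAut_two_mul_rhoAut :
    epsAut 2 * rhoAut (1 : Fin 3) 0 (by decide) = rhoAut 1 0 (by decide) * epsAut 2 := by
  refine mulAut_ext fun k => ?_
  fin_cases k <;> simp [epsAut_of, rhoAut_of]

theorem epsAut_zero_mul_rhoAut :
    epsAut 0 * rhoAut (1 : Fin 3) 0 (by decide) * epsAut 0 * rhoAut 1 0 (by decide) = 1 := by
  refine mulAut_ext fun k => ?_
  fin_cases k <;> simp [epsAut_of, rhoAut_of]

theorem rhoAut_mul_epsAut_zero :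
    rhoAut (1 : Fin 3) 0 (by decide) * epsAut 0 * rhoAut 1 0 (by decide) * epsAut 0 = 1 := by
  refine mulAut_ext fun k => ?_
  fin_cases k <;> simp [epsAut_of, rhoAut_of]

theorem rhoAut_comm_left_self :
    epsAut 1 * rhoAut (1 : Fin 3) 0 (by decide) * epsAut 1 * rhoAut 1 0 (by decide) =
      rhoAut 1 0 (by decide) * epsAut 1 * rhoAut 1 0 (by decide) * epsAut 1 := by
  refine mulAut_ext fun k => ?_
  fin_cases k <;> simp [rhoAut_of, epsAut_of, mul_assoc]

end Rank3

/-- Linear operators which satisfy the relations of `Out(F_3)` among the sign changes `ε i`, the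
permutations `t σ` and the transvection `T = ρ_{21}`. -/
structure NielsenAction (K V : Type*) [Field K] [AddCommGroup V] [Module K V] where
  ε : Fin 3 → Module.End K V
  t : Equiv.Perm (Fin 3) →* Module.End K V
  T : Module.End K V
  eps_eps : ∀ i v, ε i (ε i v) = v
  eps_comm : ∀ i j v, ε i (ε j v) = ε j (ε i v)
  perm_eps : ∀ σ i v, t σ (ε i v) = ε (σ i) (t σ v)
  eps_two : ∀ v, ε 2 (T v) = T (ε 2 v)
  inv_left : ∀ v, ε 0 (T (ε 0 (T v))) = v
  inv_right : ∀ v, T (ε 0 (T (ε 0 v))) = v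
  comm_self : ∀ v, ε 1 (T (ε 1 (T v))) = T (ε 1 (T (ε 1 v)))
  -- Conjugating both a_2 and a_3 by a_1 is an inner automorphism; the other relations hold already
  -- in Aut(F_3).
  partial_conj : ∀ v, T (ε 1 (T (ε 1 (t (swap 1 2) (T (t (swap 1 2) (ε 2
    (t (swap 1 2) (T (t (swap 1 2) (ε 2 v))))))))))) = v
  order_three : ∀ v, t (swap 0 1) (T (ε 1 (t (swap 0 1) (T (ε 1 (t (swap 0 1) (T (ε 1 v)))))))) = v
  comm : ∀ v, T (t (swap 1 2) (T (t (swap 1 2) v))) = t (swap 1 2) (T (t (swap 1 2) (T v)))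
  -- Right multiplication of a_2 by a_1 commutes with left multiplication of a_2 by a_3⁻¹.
  comm_left : ∀ v, T (ε 1 (t (swap 0 2) (T (t (swap 0 2) (ε 1 v))))) =
    ε 1 (t (swap 0 2) (T (t (swap 0 2) (ε 1 (T v)))))
  -- ρ_32 ρ_21 ρ_31 = ρ_21 ρ_32.
  steinberg : ∀ v, t (swap 0 1) (t (swap 1 2) (T (t (swap 1 2) (t (swap 0 1)
    (T (t (swap 1 2) (T (t (swap 1 2) v)))))))) =
      T (t (swap 0 1) (t (swap 1 2) (T (t (swap 1 2) (t (swap 0 1) v)))))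

/-! ### Weight spaces and their projections -/

namespace NielsenAction

variable {K V : Type*} [Field K] [AddCommGroup V] [Module K V] (A : NielsenAction K V)

/-- The simultaneous eigenspaces of the `ε i`. -/
def weight (I : Finset (Fin 3)) : Submodule K V :=
  ⨅ i : Fin 3, Module.End.eigenspace (A.ε i) (if i ∈ I then -1 else 1)

theorem mem_weight {I : Finset (Fin 3)} {v : V} :
    v ∈ A.weight I ↔ ∀ i, A.ε i v = (if i ∈ I then (-1 : K) else 1) • v := by
  simp [weight]

theorem mem_weight_empty {v : V} :
    v ∈ A.weight ∅ ↔ A.ε 0 v = v ∧ A.ε 1 v = v ∧ A.ε 2 v = v := by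
  simp [mem_weight, Fin.forall_fin_succ]

theorem mem_weight_zero {v : V} :
    v ∈ A.weight {0} ↔ A.ε 0 v = -v ∧ A.ε 1 v = v ∧ A.ε 2 v = v := by
  simp [mem_weight, Fin.forall_fin_succ]

theorem mem_weight_one {v : V} :
    v ∈ A.weight {1} ↔ A.ε 0 v = v ∧ A.ε 1 v = -v ∧ A.ε 2 v = v := by
  simp [mem_weight, Fin.forall_fin_succ]

theorem mem_weight_two {v : V} :
    v ∈ A.weight {2} ↔ A.ε 0 v = v ∧ A.ε 1 v = v ∧ A.ε 2 v = -v := by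
  simp [mem_weight, Fin.forall_fin_succ]

theorem mem_weight_univ {v : V} :
    v ∈ A.weight {0, 1, 2} ↔ A.ε 0 v = -v ∧ A.ε 1 v = -v ∧ A.ε 2 v = -v := by
  simp [mem_weight, Fin.forall_fin_succ]

theorem perm_mem_weight (σ : Equiv.Perm (Fin 3)) {I : Finset (Fin 3)} {v : V}
    (hv : v ∈ A.weight I) : A.t σ v ∈ A.weight (I.map σ.toEmbedding) := by
  rw [mem_weight] at hv ⊢
  intro i
  have h := A.perm_eps σ (σ.symm i) v
  rw [Equiv.apply_symm_apply, hv, map_smul] at h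
  rw [← h]
  have : i ∈ I.map σ.toEmbedding ↔ σ.symm i ∈ I := by
    rw [Finset.mem_map_equiv]
  simp only [this]

/-- The projection to the eigenspace of `ε i`. -/
noncomputable def halfProj (i : Fin 3) (J : Finset (Fin 3)) : Module.End K V :=
  (2 : K)⁻¹ • (1 + (if i ∈ J then (-1 : K) else 1) • A.ε i)

/-- The projection `p_J` to the space `weight J`. -/
noncomputable def proj (J : Finset (Fin 3)) : Module.End K V :=
  A.halfProj 0 J * A.halfProj 1 J * A.halfProj 2 J

theorem halfProj_apply (i : Fin 3) (J : Finset (Fin 3)) (v : V) :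
    A.halfProj i J v = (2 : K)⁻¹ • (v + (if i ∈ J then (-1 : K) else 1) • A.ε i v) := by
  simp only [halfProj, LinearMap.smul_apply, LinearMap.add_apply, Module.End.one_apply]

theorem eps_halfProj (i j : Fin 3) (J : Finset (Fin 3)) (v : V) :
    A.ε i (A.halfProj j J v) = A.halfProj j J (A.ε i v) := by
  simp only [halfProj_apply, map_smul, map_add, A.eps_comm i j]

theorem eps_halfProj_self (i : Fin 3) (J : Finset (Fin 3)) (v : V) :
    A.ε i (A.halfProj i J v) = (if i ∈ J then (-1 : K) else 1) • A.halfProj i J v := by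
  simp only [halfProj_apply, map_smul, map_add, A.eps_eps]
  split_ifs <;> module

theorem proj_mem (J : Finset (Fin 3)) (v : V) : A.proj J v ∈ A.weight J := by
  rw [mem_weight]
  intro i
  simp only [proj, Module.End.mul_apply]
  fin_cases i
  · exact A.eps_halfProj_self 0 J _
  · simp only [Fin.mk_one, A.eps_halfProj 1 0, A.eps_halfProj_self 1, map_smul]
  · simp only [Fin.reduceFinMk, A.eps_halfProj 2 0, A.eps_halfProj 2 1, A.eps_halfProj_self 2,
      map_smul]

theorem eps_proj (i : Fin 3) (J : Finset (Fin 3)) (v : V) :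
    A.ε i (A.proj J v) = A.proj J (A.ε i v) := by
  simp only [proj, Module.End.mul_apply, eps_halfProj]

variable (h2 : (2 : K) ≠ 0)

include h2

theorem halfProj_of_mem (i : Fin 3) {I : Finset (Fin 3)} (J : Finset (Fin 3)) {v : V}
    (hv : v ∈ A.weight I) : A.halfProj i J v = if (i ∈ I ↔ i ∈ J) then v else 0 := by
  rw [halfProj_apply, (A.mem_weight.1 hv)]
  have h : (2 : K)⁻¹ • (v + v) = v := by
    rw [← two_smul K v, smul_smul, inv_mul_cancel₀ h2, one_smul]
  by_cases hi : i ∈ I <;> by_cases hj : i ∈ J <;> simp [hi, hj] <;> simpa using h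

theorem proj_of_mem {I J : Finset (Fin 3)} {v : V} (hv : v ∈ A.weight I) :
    A.proj J v = if I = J then v else 0 := by
  have h : I = J ↔ (0 ∈ I ↔ 0 ∈ J) ∧ (1 ∈ I ↔ 1 ∈ J) ∧ (2 ∈ I ↔ 2 ∈ J) := by
    simp [Finset.ext_iff, Fin.forall_fin_succ]
  simp only [proj, Module.End.mul_apply, A.halfProj_of_mem h2 2 J hv]
  by_cases h0 : (2 ∈ I ↔ 2 ∈ J)
  · rw [if_pos h0, A.halfProj_of_mem h2 1 J hv]
    by_cases h1 : (1 ∈ I ↔ 1 ∈ J)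
    · rw [if_pos h1, A.halfProj_of_mem h2 0 J hv]
      simp only [h, h0, h1, and_true]
    · rw [if_neg h1, map_zero, if_neg (by tauto)]
  · rw [if_neg h0, map_zero, map_zero, if_neg (by tauto)]

theorem sum_proj (v : V) : ∑ J, A.proj J v = v := by
  have hu : (Finset.univ : Finset (Finset (Fin 3))) =
      {∅, {0}, {1}, {2}, {0, 1}, {0, 2}, {1, 2}, {0, 1, 2}} := by decide
  have h8 : (2 : K)⁻¹ * (2⁻¹ * (2⁻¹ * 8)) = 1 := by
    have : (8 : K) = 2 * 2 * 2 := by norm_num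
    rw [this]; field_simp
  rw [hu]
  repeat rw [Finset.sum_insert (by decide)]
  rw [Finset.sum_singleton]
  simp only [proj, Module.End.mul_apply, halfProj_apply, map_smul, map_add]
  simp only [Finset.notMem_empty, Finset.mem_insert, Finset.mem_singleton, if_true, if_false,
    zero_ne_one, one_ne_zero, or_true, or_false, Fin.reduceEq]
  calc _ = ((2 : K)⁻¹ * (2⁻¹ * (2⁻¹ * 8))) • v := by module
    _ = v := by rw [h8, one_smul]

omit h2 in
theorem proj_eq_zero {J : Finset (Fin 3)} (hJ : A.weight J = ⊥) (v : V) : A.proj J v = 0 := by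
  have := A.proj_mem J v
  rwa [hJ, Submodule.mem_bot] at this

theorem sum_eq_proj {v : V} (w : (L : Finset (Fin 3)) → A.weight L) (hv : v = ∑ L, (w L : V))
    (J : Finset (Fin 3)) : (w J : V) = A.proj J v := by
  rw [hv, map_sum, Finset.sum_eq_single J]
  · rw [A.proj_of_mem h2 (w J).2, if_pos rfl]
  · intro L _ hL
    rw [A.proj_of_mem h2 (w L).2, if_neg hL]
  · simp

theorem iSupIndep_weight : iSupIndep A.weight := by
  rw [iSupIndep_def]
  intro I
  rw [Submodule.disjoint_def]
  intro v hv hv'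
  have h : ∀ x ∈ ⨆ J, ⨆ (_ : J ≠ I), A.weight J, A.proj I x = 0 := by
    intro x hx
    have hle : (⨆ J, ⨆ (_ : J ≠ I), A.weight J) ≤ LinearMap.ker (A.proj I) := by
      refine iSup_le fun J => iSup_le fun hJ y hy => ?_
      rw [LinearMap.mem_ker, A.proj_of_mem h2 hy, if_neg hJ]
    exact hle hx
  rw [← h v hv', A.proj_of_mem h2 hv, if_pos rfl]

end NielsenAction

/-! ### The action of ρ_21 when V_2 = 0 and dim E_1 = 1 -/

namespace NielsenAction

variable {K V : Type*} [Field K] [AddCommGroup V] [Module K V] (A : NielsenAction K V)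

theorem perm_perm (σ τ : Equiv.Perm (Fin 3)) (v : V) : A.t σ (A.t τ v) = A.t (σ * τ) v := by
  rw [map_mul, Module.End.mul_apply]

theorem swap_swap (i j : Fin 3) (v : V) : A.t (swap i j) (A.t (swap i j) v) = v := by
  rw [perm_perm, Equiv.swap_mul_self, map_one, Module.End.one_apply]

theorem perm_injective (σ : Equiv.Perm (Fin 3)) : Function.Injective (A.t σ) := by
  intro v w h
  have := congrArg (A.t σ⁻¹) h
  simpa [perm_perm] using this

theorem T_injective : Function.Injective A.T := by
  intro v w h
  rw [← A.inv_left v, h, A.inv_left]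

theorem perm_mem_weight_empty (σ : Equiv.Perm (Fin 3)) {v : V} (hv : v ∈ A.weight ∅) :
    A.t σ v ∈ A.weight ∅ := by
  simpa using A.perm_mem_weight σ hv

theorem perm_mem_weight_univ (σ : Equiv.Perm (Fin 3)) {v : V} (hv : v ∈ A.weight {0, 1, 2}) :
    A.t σ v ∈ A.weight {0, 1, 2} := by
  have h : ({0, 1, 2} : Finset (Fin 3)) = Finset.univ := by decide
  have := A.perm_mem_weight σ hv
  rw [h] at this ⊢
  simpa using this

/-- Vectors spanning the lines `E_1, E_2, E_3`, permuted by the transpositions up to a common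
sign `η`, where all spaces `E_{i,j}` vanish. -/
structure IsFrame (e₀ e₁ e₂ : V) (η : K) : Prop where
  two_ne : (2 : K) ≠ 0
  weight_two : ∀ I : Finset (Fin 3), I.card = 2 → A.weight I = ⊥
  mem₀ : e₀ ∈ A.weight {0}
  mem₁ : e₁ ∈ A.weight {1}
  mem₂ : e₂ ∈ A.weight {2}
  ne₀ : e₀ ≠ 0
  ne₁ : e₁ ≠ 0
  ne₂ : e₂ ≠ 0
  span₀ : ∀ v ∈ A.weight {0}, ∃ c : K, v = c • e₀
  span₁ : ∀ v ∈ A.weight {1}, ∃ c : K, v = c • e₁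
  span₂ : ∀ v ∈ A.weight {2}, ∃ c : K, v = c • e₂
  sq : η * η = 1
  t01_0 : A.t (swap 0 1) e₀ = e₁
  t01_1 : A.t (swap 0 1) e₁ = e₀
  t01_2 : A.t (swap 0 1) e₂ = η • e₂
  t02_0 : A.t (swap 0 2) e₀ = e₂
  t02_1 : A.t (swap 0 2) e₁ = η • e₁
  t02_2 : A.t (swap 0 2) e₂ = e₀
  t12_0 : A.t (swap 1 2) e₀ = η • e₀
  t12_1 : A.t (swap 1 2) e₁ = η • e₂
  t12_2 : A.t (swap 1 2) e₂ = η • e₁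

theorem exists_isFrame [FiniteDimensional K V] (h2 : (2 : K) ≠ 0)
    (hV2 : ∀ I : Finset (Fin 3), I.card = 2 → A.weight I = ⊥)
    (h1 : Module.finrank K (A.weight {0}) = 1) : ∃ e₀ e₁ e₂ η, A.IsFrame e₀ e₁ e₂ η := by
  obtain ⟨⟨e, he⟩, hne, hspan⟩ := finrank_eq_one_iff'.1 h1
  have hne : e ≠ 0 := fun h => hne (Subtype.ext h)
  have hspan : ∀ v ∈ A.weight {0}, ∃ c : K, v = c • e := by
    intro v hv
    obtain ⟨c, hc⟩ := hspan ⟨v, hv⟩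
    exact ⟨c, (congrArg Subtype.val hc).symm⟩
  have m1 : ∀ v ∈ A.weight {0}, A.t (swap 0 1) v ∈ A.weight {1} := fun v hv => by
    simpa using A.perm_mem_weight (swap 0 1) hv
  have m2 : ∀ v ∈ A.weight {0}, A.t (swap 0 2) v ∈ A.weight {2} := fun v hv => by
    simpa using A.perm_mem_weight (swap 0 2) hv
  have m1' : ∀ v ∈ A.weight {1}, A.t (swap 0 1) v ∈ A.weight {0} := fun v hv => by
    simpa using A.perm_mem_weight (swap 0 1) hv
  have m2' : ∀ v ∈ A.weight {2}, A.t (swap 0 2) v ∈ A.weight {0} := fun v hv => by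
    simpa using A.perm_mem_weight (swap 0 2) hv
  have m0 : A.t (swap 1 2) e ∈ A.weight {0} := by
    have := A.perm_mem_weight (swap 1 2) he
    rwa [Finset.map_singleton, Equiv.toEmbedding_apply,
      Equiv.swap_apply_of_ne_of_ne (by decide) (by decide)] at this
  obtain ⟨η, hη⟩ := hspan _ m0
  have hsq : η * η = 1 := by
    have h := A.swap_swap 1 2 e
    rw [hη, map_smul, hη, smul_smul] at h
    have h' : (η * η - 1) • e = 0 := by rw [sub_smul, h, one_smul, sub_self]
    exact sub_eq_zero.1 ((smul_eq_zero.1 h').resolve_right hne)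
  have p1 : swap (0 : Fin 3) 1 * swap 0 2 = swap 0 2 * swap 1 2 := by decide
  have p2 : swap (0 : Fin 3) 2 * swap 0 1 = swap 0 1 * swap 1 2 := by decide
  have p3 : swap (1 : Fin 3) 2 * swap 0 1 = swap 0 2 * swap 1 2 := by decide
  have p4 : swap (1 : Fin 3) 2 * swap 0 2 = swap 0 1 * swap 1 2 := by decide
  refine ⟨e, A.t (swap 0 1) e, A.t (swap 0 2) e, η, h2, hV2, he, m1 e he, m2 e he, hne, ?_, ?_,
    hspan, ?_, ?_, hsq, rfl, A.swap_swap 0 1 e, ?_, rfl, ?_, A.swap_swap 0 2 e, hη, ?_, ?_⟩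
  · exact fun h => hne (A.perm_injective _ (h.trans (map_zero _).symm))
  · exact fun h => hne (A.perm_injective _ (h.trans (map_zero _).symm))
  · intro v hv
    obtain ⟨c, hc⟩ := hspan _ (m1' v hv)
    exact ⟨c, by rw [← A.swap_swap 0 1 v, hc, map_smul]⟩
  · intro v hv
    obtain ⟨c, hc⟩ := hspan _ (m2' v hv)
    exact ⟨c, by rw [← A.swap_swap 0 2 v, hc, map_smul]⟩
  · rw [perm_perm, p1, ← perm_perm, hη, map_smul]
  · rw [perm_perm, p2, ← perm_perm, hη, map_smul]
  · rw [perm_perm, p3, ← perm_perm, hη, map_smul]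
  · rw [perm_perm, p4, ← perm_perm, hη, map_smul]

namespace IsFrame

variable {A} {e₀ e₁ e₂ : V} {η : K} (F : A.IsFrame e₀ e₁ e₂ η)

include F

theorem eps : (A.ε 0 e₀ = -e₀ ∧ A.ε 1 e₀ = e₀ ∧ A.ε 2 e₀ = e₀) ∧
    (A.ε 0 e₁ = e₁ ∧ A.ε 1 e₁ = -e₁ ∧ A.ε 2 e₁ = e₁) ∧
    (A.ε 0 e₂ = e₂ ∧ A.ε 1 e₂ = e₂ ∧ A.ε 2 e₂ = -e₂) :=
  ⟨A.mem_weight_zero.1 F.mem₀, A.mem_weight_one.1 F.mem₁, A.mem_weight_two.1 F.mem₂⟩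

theorem eq_zero_of_two_smul {v : V} (h : (2 : K) • v = 0) : v = 0 :=
  (smul_eq_zero.1 h).resolve_left F.two_ne

theorem coord_eq_zero {a b c : K} {z h : V} (hz : z ∈ A.weight ∅) (hh : h ∈ A.weight {0, 1, 2})
    (hs : a • e₀ + b • e₁ + c • e₂ + z + h = 0) : a = 0 ∧ b = 0 ∧ c = 0 ∧ z = 0 ∧ h = 0 := by
  obtain ⟨⟨x1, x2, x3⟩, ⟨y1, y2, y3⟩, ⟨w1, w2, w3⟩⟩ := F.eps
  obtain ⟨z1, z2, z3⟩ := A.mem_weight_empty.1 hz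
  obtain ⟨h1, h2, h3⟩ := A.mem_weight_univ.1 hh
  have s0 := congrArg (A.ε 0) hs
  have s1 := congrArg (A.ε 1) hs
  have s2 := congrArg (A.ε 2) hs
  simp only [map_zero, map_add, map_smul, x1, x2, x3, y1, y2, y3, w1, w2, w3, z1, z2, z3, h1, h2,
    h3] at s0 s1 s2
  have k0 : a • e₀ + h = 0 := F.eq_zero_of_two_smul (by linear_combination (norm := module) hs - s0)
  have k1 : b • e₁ + h = 0 := F.eq_zero_of_two_smul (by linear_combination (norm := module) hs - s1)
  have k2 : c • e₂ + h = 0 := F.eq_zero_of_two_smul (by linear_combination (norm := module) hs - s2)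
  have k3 := congrArg (A.ε 1) k0
  simp only [map_zero, map_add, map_smul, x2, h2] at k3
  have k4 : a • e₀ = 0 := F.eq_zero_of_two_smul (by linear_combination (norm := module) k0 + k3)
  rw [k4, zero_add] at k0
  rw [k0, add_zero] at k1 k2
  rw [k0, k1, k2, k4] at hs
  refine ⟨(smul_eq_zero.1 k4).resolve_right F.ne₀, (smul_eq_zero.1 k1).resolve_right F.ne₁,
    (smul_eq_zero.1 k2).resolve_right F.ne₂, by simpa using hs, k0⟩

theorem exists_low {v : V} (hv : A.ε 2 v = v) :
    ∃ a b : K, ∃ z ∈ A.weight ∅, v = a • e₀ + b • e₁ + z := by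
  have hu : (Finset.univ : Finset (Finset (Fin 3))) =
      {∅, {0}, {1}, {2}, {0, 1}, {0, 2}, {1, 2}, {0, 1, 2}} := by decide
  have hz : ∀ J : Finset (Fin 3), 2 ∈ J → A.proj J v = 0 := by
    intro J hJ
    have h1 := A.eps_proj 2 J v
    rw [hv, (A.mem_weight.1 (A.proj_mem J v)) 2, if_pos hJ] at h1
    exact F.eq_zero_of_two_smul (by linear_combination (norm := module) -h1)
  obtain ⟨a, ha⟩ := F.span₀ _ (A.proj_mem {0} v)
  obtain ⟨b, hb⟩ := F.span₁ _ (A.proj_mem {1} v)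
  refine ⟨a, b, A.proj ∅ v, A.proj_mem ∅ v, ?_⟩
  have hs := A.sum_proj F.two_ne v
  rw [hu] at hs
  repeat rw [Finset.sum_insert (by decide)] at hs
  rw [Finset.sum_singleton, hz {2} (by decide), hz {0, 2} (by decide), hz {1, 2} (by decide),
    hz {0, 1, 2} (by decide), A.proj_eq_zero (F.weight_two {0, 1} (by decide)), ha, hb] at hs
  exact hs.symm.trans (by module)

theorem exists_high {v : V} (hv : A.ε 2 v = -v) :
    ∃ c : K, ∃ h ∈ A.weight {0, 1, 2}, v = c • e₂ + h := by
  have hu : (Finset.univ : Finset (Finset (Fin 3))) =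
      {∅, {0}, {1}, {2}, {0, 1}, {0, 2}, {1, 2}, {0, 1, 2}} := by decide
  have hz : ∀ J : Finset (Fin 3), 2 ∉ J → A.proj J v = 0 := by
    intro J hJ
    have h1 := A.eps_proj 2 J v
    rw [hv, (A.mem_weight.1 (A.proj_mem J v)) 2, if_neg hJ, map_neg] at h1
    exact F.eq_zero_of_two_smul (by linear_combination (norm := module) h1)
  obtain ⟨c, hc⟩ := F.span₂ _ (A.proj_mem {2} v)
  refine ⟨c, A.proj {0, 1, 2} v, A.proj_mem _ v, ?_⟩
  have hs := A.sum_proj F.two_ne v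
  rw [hu] at hs
  repeat rw [Finset.sum_insert (by decide)] at hs
  rw [Finset.sum_singleton, hz {0} (by decide), hz {1} (by decide), hz {0, 1} (by decide),
    hz ∅ (by decide), A.proj_eq_zero (F.weight_two {0, 2} (by decide)),
    A.proj_eq_zero (F.weight_two {1, 2} (by decide)), hc] at hs
  exact hs.symm.trans (by module)

theorem T_high {v : V} (hv : A.ε 2 v = -v) :
    ∃ c : K, ∃ h ∈ A.weight {0, 1, 2}, A.T v = c • e₂ + h :=
  F.exists_high (by rw [A.eps_two, hv, map_neg])

theorem T_low {v : V} (hv : A.ε 2 v = v) :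
    ∃ a b : K, ∃ z ∈ A.weight ∅, A.T v = a • e₀ + b • e₁ + z :=
  F.exists_low (by rw [A.eps_two, hv])

/-- The operator on the left is ρ_31, so its effect on E_2 is read off from that of ρ_21 on E_3. -/
theorem B_e₁ {f : K} {h : V} (hT : A.T e₂ = f • e₂ + h) :
    A.t (swap 1 2) (A.T (A.t (swap 1 2) e₁)) = f • e₁ + η • A.t (swap 1 2) h := by
  rw [F.t12_1, map_smul, hT, map_smul, map_add, map_smul, F.t12_2]
  linear_combination (norm := module) (f * F.sq) • e₁

/-- On E_3 ⊕ V_3 the operators `ε 0` and `ε 1` agree, so T `ε 1` T `ε 1` = T `ε 0` T `ε 0` = 1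
there. Conjugating by `swap 1 2`, the partial conjugation of a_3 by a_1 fixes `e₁`; as the two
partial conjugations compose to an inner automorphism, so does that of a_2. -/
theorem partial_conj_e₁ : A.T (A.ε 1 (A.T (A.ε 1 e₁))) = e₁ := by
  obtain ⟨⟨x1, x2, x3⟩, ⟨y1, y2, y3⟩, ⟨w1, w2, w3⟩⟩ := F.eps
  obtain ⟨f, h, hh, hT⟩ := F.T_high w3
  have hh' := A.perm_mem_weight_univ (swap 1 2) hh
  obtain ⟨h1, h2, h3⟩ := A.mem_weight_univ.1 hh
  obtain ⟨h1', h2', h3'⟩ := A.mem_weight_univ.1 hh'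
  have hB2 : A.t (swap 1 2) (A.T (A.t (swap 1 2) (A.ε 2 (f • e₁ + η • A.t (swap 1 2) h)))) =
      e₁ := by
    rw [map_add, map_smul, map_smul, y3, h3', smul_neg, ← sub_eq_add_neg, map_sub, map_smul,
      map_smul, A.swap_swap, F.t12_1]
    have k := A.inv_right e₂
    rw [w1, hT, map_add, map_smul, w1, h1] at k
    have : f • η • e₂ - η • h = η • (f • e₂ + -h) := by module
    rw [this, map_smul, k, map_smul, F.t12_2, smul_smul, F.sq, one_smul]
  have k := A.partial_conj e₁
  rw [y3, F.B_e₁ hT, hB2] at k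
  exact k

/-- Comparing `partial_conj_e₁` with T `ε 0` T `ε 0` = 1 and cancelling T, the V_0-component of T
`e₁` equals its own negative. -/
theorem T_e₁ : ∃ r a : K, A.T e₁ = r • e₀ + a • e₁ := by
  obtain ⟨⟨x1, x2, x3⟩, ⟨y1, y2, y3⟩, ⟨w1, w2, w3⟩⟩ := F.eps
  obtain ⟨r, a, z, hz, hT⟩ := F.T_low y3
  obtain ⟨z1, z2, z3⟩ := A.mem_weight_empty.1 hz
  refine ⟨r, a, ?_⟩
  have k := A.T_injective (F.partial_conj_e₁.trans (A.inv_right e₁).symm)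
  simp only [y1, y2, x1, x2, z1, z2, map_neg, hT, map_add, map_smul] at k
  have : z = 0 := F.eq_zero_of_two_smul (by linear_combination (norm := module) -k)
  rw [hT, this, add_zero]

/-- Let P = T `ε 1` T `ε 1` and let b be the `e₁`-coefficient of T z. As P commutes with `ε 1`, it
maps `ε 0` T z to `ε 1` T z and `ε 1` `ε 0` T z to T z. The difference says that P maps 2b `e₁` to
its negative, whereas P fixes `e₁`. -/
theorem T_z {z : V} (hz : z ∈ A.weight ∅) :
    ∃ p : K, ∃ d ∈ A.weight ∅, A.T z = p • e₀ + d := by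
  obtain ⟨⟨x1, x2, x3⟩, ⟨y1, y2, y3⟩, ⟨w1, w2, w3⟩⟩ := F.eps
  obtain ⟨z1, z2, z3⟩ := A.mem_weight_empty.1 hz
  obtain ⟨p, b, d, hd, hT⟩ := F.T_low z3
  obtain ⟨d1, d2, d3⟩ := A.mem_weight_empty.1 hd
  refine ⟨p, d, hd, ?_⟩
  have k1 : A.T (A.ε 1 (A.T (A.ε 1 (A.ε 1 (A.ε 0 (A.T z)))))) = A.T z := by
    rw [A.eps_eps]
    have := A.inv_right z
    rw [z1] at this
    rw [this, z2]
  have k2 := A.comm_self (A.ε 1 (A.ε 1 (A.ε 0 (A.T z))))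
  rw [k1, A.eps_eps] at k2
  have k3 : A.T (A.ε 1 (A.T (A.ε 1 (A.ε 0 (A.T z) - A.ε 1 (A.ε 0 (A.T z)))))) =
      A.ε 1 (A.T z) - A.T z := by
    simp only [map_sub]
    rw [k1, ← k2]
  have k4 : A.ε 0 (A.T z) - A.ε 1 (A.ε 0 (A.T z)) = (2 * b) • e₁ := by
    simp only [hT, map_add, map_smul, map_neg, x1, x2, y1, y2, d1, d2]
    module
  have k5 : A.ε 1 (A.T z) - A.T z = -((2 * b) • e₁) := by
    simp only [hT, map_add, map_smul, x2, y2, d2]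
    module
  rw [k4, k5, map_smul, map_smul, map_smul, map_smul, F.partial_conj_e₁] at k3
  have k6 : b • e₁ = 0 := F.eq_zero_of_two_smul
    (F.eq_zero_of_two_smul (by linear_combination (norm := module) k3))
  rw [hT, k6, add_zero]

theorem low_eq_zero {a b : K} {z : V} (hz : z ∈ A.weight ∅) (hs : a • e₀ + b • e₁ + z = 0) :
    a = 0 ∧ b = 0 ∧ z = 0 := by
  obtain ⟨h1, h2, -, h3, -⟩ := F.coord_eq_zero (a := a) (b := b) (c := 0) hz
    (Submodule.zero_mem (A.weight {0, 1, 2})) (by simpa using hs)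
  exact ⟨h1, h2, h3⟩

theorem high_eq_zero {c : K} {h : V} (hh : h ∈ A.weight {0, 1, 2}) (hs : c • e₂ + h = 0) :
    c = 0 ∧ h = 0 := by
  obtain ⟨-, -, h1, -, h2⟩ := F.coord_eq_zero (a := 0) (b := 0) (c := c)
    (Submodule.zero_mem (A.weight ∅)) hh (by simpa using hs)
  exact ⟨h1, h2⟩

/-- There are no edges in both directions between `E_1` and `E_2`. -/
theorem not_e₀_e₁ {s q r : K} (h0 : A.T e₀ = s • e₀ + q • e₁) (h1 : A.T e₁ = r • e₀ + s • e₁)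
    (hdet : s * s - q * r = 1) (hq : q ≠ 0) (hr : r ≠ 0) : False := by
  obtain ⟨⟨x1, x2, x3⟩, ⟨y1, y2, y3⟩, ⟨w1, w2, w3⟩⟩ := F.eps
  obtain ⟨f, h, hh, hT⟩ := F.T_high w3
  have hh' := A.perm_mem_weight_univ (swap 1 2) hh
  have hB0 : A.t (swap 1 2) (A.T (A.t (swap 1 2) e₀)) = s • e₀ + q • e₂ := by
    rw [F.t12_0, map_smul, h0, map_smul, map_add, map_smul, map_smul, F.t12_0, F.t12_1]
    linear_combination (norm := module) (s * F.sq) • e₀ + (q * F.sq) • e₂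
  have hB1 := F.B_e₁ hT
  -- The commutation of ρ_21 with ρ_31 on `e₀` makes the diagonal coefficients on E_1 and E_3 equal.
  have hfs : f = s := by
    have k := A.comm e₀
    rw [hB0, h0] at k
    simp only [map_add, map_smul, hB0, hB1, h0, hT] at k
    obtain ⟨-, k1, -⟩ := F.coord_eq_zero (a := 0) (b := s * q - q * f) (c := q * f - s * q)
      (Submodule.zero_mem (A.weight ∅))
      ((A.weight {0, 1, 2}).sub_mem ((A.weight {0, 1, 2}).smul_mem q hh)
        ((A.weight {0, 1, 2}).smul_mem (q * η) hh'))
      (by linear_combination (norm := module) k)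
    have k2 : q * (s - f) = 0 := by linear_combination k1
    exact (sub_eq_zero.1 ((mul_eq_zero.1 k2).resolve_left hq)).symm
  subst hfs
  have hh1 : η • A.t (swap 1 2) h ∈ A.weight {0, 1, 2} := (A.weight {0, 1, 2}).smul_mem η hh'
  generalize hh1' : η • A.t (swap 1 2) h = h₁ at hB1 hh1
  let R : Module.End K V := A.t (swap 0 1) * A.t (swap 1 2) * A.T * A.t (swap 1 2) * A.t (swap 0 1)
  have hR : ∀ v, R v = A.t (swap 0 1) (A.t (swap 1 2) (A.T (A.t (swap 1 2) (A.t (swap 0 1) v)))) :=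
    fun _ => rfl
  have hR1 : R e₁ = f • e₁ + (q * η) • e₂ := by
    rw [hR, F.t01_1, hB0, map_add, map_smul, map_smul, F.t01_0, F.t01_2, smul_smul]
  have hReps : ∀ v, R (A.ε 0 v) = A.ε 0 (R v) := by
    intro v
    rw [hR, hR, A.perm_eps, Equiv.swap_apply_left, A.perm_eps, Equiv.swap_apply_left, ← A.eps_two,
      A.perm_eps, Equiv.swap_apply_right, A.perm_eps, Equiv.swap_apply_right]
  have hinj : Function.Injective R :=
    (A.perm_injective _).comp ((A.perm_injective _).comp (A.T_injective.comp
      ((A.perm_injective _).comp (A.perm_injective _))))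
  obtain ⟨c, k, hk, hTk⟩ := F.T_high (A.mem_weight_univ.1 hh1).2.2
  obtain ⟨k1, k2, k3⟩ := A.mem_weight_univ.1 hk
  obtain ⟨h1', h2', h3'⟩ := A.mem_weight_univ.1 hh
  -- `R` is ρ_32 and commutes with `ε 0`. Applying 1 + `ε 0` to the Steinberg relation at `e₁` kills
  -- the components in E_1 and V_3 and leaves 2f `R e₁` on the right, so `R` can be cancelled.
  have hsum : A.T (f • e₁ + h₁) + A.ε 0 (A.T (f • e₁ + h₁)) = (2 * f) • e₁ := by
    apply hinj
    have hst : R (A.T (A.t (swap 1 2) (A.T (A.t (swap 1 2) e₁)))) = A.T (R e₁) := A.steinberg e₁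
    rw [hB1] at hst
    rw [map_add R, hReps, hst, map_smul, hR1]
    simp only [map_smul, map_add, h1, hT, x1, y1, w1, h1']
    module
  simp only [map_add, map_smul, h1, hTk, x1, y1, w1, k1] at hsum
  obtain ⟨-, c1, c2, -, -⟩ := F.coord_eq_zero (a := 0) (b := 2 * (f * f - f)) (c := 2 * c)
    (Submodule.zero_mem (A.weight ∅)) (Submodule.zero_mem (A.weight {0, 1, 2}))
    (by linear_combination (norm := module) hsum)
  have c1 := (mul_eq_zero.1 c1).resolve_left F.two_ne
  have c2 := (mul_eq_zero.1 c2).resolve_left F.two_ne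
  have hf : f = 0 := by
    have : f * (f - 1) = 0 := by linear_combination c1
    rcases mul_eq_zero.1 this with h | h
    · exact h
    · exact absurd (mul_eq_zero.1 (show q * r = 0 by linear_combination (f + 1) * h - hdet))
        (by simp [hq, hr])
  subst hf
  -- With f = 0 the commutation of ρ_21 with ρ_31 puts a nonzero multiple of `e₂` into V_3.
  have kc := A.comm e₁
  rw [hB1, h1] at kc
  simp only [zero_smul, zero_add, add_zero, map_smul, hB0, hTk, c2] at kc
  obtain ⟨c3, -⟩ := F.high_eq_zero (c := r * q) ((A.weight {0, 1, 2}).neg_mem hk)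
    (by linear_combination (norm := module) -kc)
  exact mul_ne_zero hr hq c3

/-- There are no edges in both directions between `E_1` and `V_0`. -/
theorem not_e₀_empty [FiniteDimensional K V] {s a : K} {z : V} (hz : z ∈ A.weight ∅) (hz0 : z ≠ 0)
    (h0 : A.T e₀ = s • e₀ + z) (h1 : A.T e₁ = a • e₁) (ha : a * a = 1)
    (hdim : Module.finrank K (A.weight {0, 1, 2}) ≤ 2) : False := by
  obtain ⟨⟨x1, x2, x3⟩, ⟨y1, y2, y3⟩, ⟨w1, w2, w3⟩⟩ := F.eps
  obtain ⟨z1, z2, z3⟩ := A.mem_weight_empty.1 hz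
  have hy := A.perm_mem_weight_empty (swap 0 1) hz
  obtain ⟨p, d, hd, hTy⟩ := F.T_z hy
  obtain ⟨-, hy2, -⟩ := A.mem_weight_empty.1 hy
  -- The order-three relation at `e₁`. It forces T to exchange `e₀` and `z` up to sign, with `swap 0
  -- 1` acting on `z` by a sign.
  obtain ⟨hs, hp, hd0⟩ : s = 0 ∧ a * p + 1 = 0 ∧ d = 0 := by
    have k := A.order_three e₁
    simp only [map_neg, map_add, map_smul, y2, h1, F.t01_1, x2, h0, F.t01_0, hy2, hTy] at k
    obtain ⟨c1, c2, c3⟩ := F.low_eq_zero (a := s * (a * a)) (b := -(a * p + 1))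
      ((A.weight ∅).smul_mem (-a) (A.perm_mem_weight_empty (swap 0 1) hd))
      (by linear_combination (norm := module) k)
    have ha0 : a ≠ 0 := by rintro rfl; simp at ha
    refine ⟨by simpa [ha] using c1, by linear_combination -c2, ?_⟩
    have c4 := (smul_eq_zero.1 c3).resolve_left (neg_ne_zero.2 ha0)
    exact A.perm_injective _ (c4.trans (map_zero _).symm)
  subst hs hd0
  rw [zero_smul, zero_add] at h0
  rw [add_zero] at hTy
  have hpp : p * p = 1 := by linear_combination (a * p - 1) * hp - p * p * ha
  have ht01 : A.t (swap 0 1) z = -(p • z) := by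
    have k := A.inv_left (A.t (swap 0 1) z)
    simp only [hTy, map_smul, x1, h0, z1, map_neg, smul_neg] at k
    exact k.symm
  have hTz : A.T z = -e₀ := by
    have k := A.inv_left e₀
    rw [h0, z1] at k
    rw [← A.eps_eps 0 (A.T z), k, x1]
  -- Once T y and T d are known, `partial_conj` at `z` becomes κ y = (1 - 2κ²) z; here κ ≠ 0 because
  -- z ≠ 0.
  obtain ⟨m, hm, ht12⟩ : ∃ m : K, m * m = 1 ∧ A.t (swap 1 2) z = m • z := by
    have hy := A.perm_mem_weight_empty (swap 1 2) hz
    generalize hy' : A.t (swap 1 2) z = y at hy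
    have hy'' : A.t (swap 1 2) y = z := by rw [← hy', A.swap_swap]
    obtain ⟨κ, d, hd, hTy⟩ := F.T_z hy
    obtain ⟨v1, v2, v3⟩ := A.mem_weight_empty.1 hy
    obtain ⟨d1, d2, d3⟩ := A.mem_weight_empty.1 hd
    have hTd : A.T d = y + κ • z := by
      have k := congrArg (A.ε 0) (A.inv_left y)
      rw [A.eps_eps, hTy] at k
      simp only [map_add, map_smul, x1, d1, h0, v1, map_neg] at k
      linear_combination (norm := module) k
    have k := A.partial_conj z
    have htd := A.perm_mem_weight_empty (swap 1 2) hd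
    obtain ⟨td1, td2, td3⟩ := A.mem_weight_empty.1 htd
    simp only [z3, hy', hTy, map_add, map_smul, F.t12_0, x3, td3, A.swap_swap, h0, hTd, hy'',
      z2, v2, hTz, map_neg, x2, d2] at k
    have k' : κ • y = (1 - 2 * κ * κ) • z := by
      have k2 : (2 : K) • (κ • y - (1 - 2 * κ * κ) • z) = 0 := by
        linear_combination (norm := module) k - (κ * F.sq) • y -
          (2 * κ * κ * F.sq) • z
      exact sub_eq_zero.1 (F.eq_zero_of_two_smul k2)
    have hκ : κ ≠ 0 := by
      rintro rfl
      apply hz0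
      linear_combination (norm := module) -k'
    have hm : y = (κ⁻¹ * (1 - 2 * κ * κ)) • z := by
      rw [mul_smul, ← k', smul_smul, inv_mul_cancel₀ hκ, one_smul]
    refine ⟨κ⁻¹ * (1 - 2 * κ * κ), ?_, hm⟩
    generalize κ⁻¹ * (1 - 2 * κ * κ) = m at hm
    rw [hm, map_smul, hy', hm, smul_smul] at hy''
    have k3 : (m * m - 1) • z = 0 := by rw [sub_smul, hy'', one_smul, sub_self]
    exact sub_eq_zero.1 ((smul_eq_zero.1 k3).resolve_right hz0)
  have ht02 : A.t (swap 0 2) z = m • z := by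
    have e : swap (0 : Fin 3) 2 = swap 0 1 * (swap 1 2 * swap 0 1) := by decide
    rw [e, ← perm_perm, ← perm_perm, ht01, map_neg, map_smul, ht12, map_neg, map_smul, map_smul,
      ht01]
    linear_combination (norm := module) (m * hpp) • z
  obtain ⟨f, h, hh, hT⟩ := F.T_high w3
  have hh' := A.perm_mem_weight_univ (swap 0 2) hh
  obtain ⟨h1', h2', h3'⟩ := A.mem_weight_univ.1 hh
  -- `comm_left` at `e₀` transfers the picture to the other block: T exchanges `e₂` and `h` up to
  -- sign.
  obtain ⟨hf, hTh'⟩ : f = 0 ∧ A.T (A.t (swap 0 2) h) = m • e₂ := by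
    obtain ⟨g1, g2, g3⟩ := A.mem_weight_univ.1 hh'
    obtain ⟨c, k, hk, hTk⟩ := F.T_high g3
    have hc := A.comm_left e₀
    simp only [x2, F.t02_0, hT, map_add, map_smul, F.t02_2, g2, map_neg, h0, hTk, z2, ht02, hTz,
      w2] at hc
    obtain ⟨-, -, c1, c2, c3⟩ := F.coord_eq_zero (a := 0) (b := 0) (c := m - c)
      ((A.weight ∅).smul_mem f hz) ((A.weight {0, 1, 2}).neg_mem hk)
      (by linear_combination (norm := module) hc)
    refine ⟨(smul_eq_zero.1 c2).resolve_right hz0, ?_⟩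
    rw [hTk, neg_eq_zero.1 c3, add_zero, sub_eq_zero.1 c1]
  subst hf
  rw [zero_smul, zero_add] at hT
  have hTh : A.T h = -e₂ := by
    have k := A.inv_left e₂
    rw [hT, h1', map_neg, map_neg] at k
    rw [← A.eps_eps 0 (A.T h), neg_eq_iff_eq_neg.1 k, map_neg, w1]
  have ht02h : A.t (swap 0 2) h = -(m • h) := by
    apply A.T_injective
    rw [hTh', map_neg, map_smul, hTh]
    module
  have hu := A.perm_mem_weight_univ (swap 1 2) hh
  have ht01u : A.t (swap 0 1) (A.t (swap 1 2) h) = -(m • A.t (swap 1 2) h) := by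
    have e : swap (0 : Fin 3) 1 * swap 1 2 = swap 1 2 * swap 0 2 := by decide
    rw [perm_perm, e, ← perm_perm, ht02h, map_neg, map_smul]
  have hTu : A.T (A.t (swap 1 2) h) = a • A.t (swap 1 2) h := by
    have hB := F.B_e₁ (f := 0) (h := h) (by rw [hT]; module)
    rw [zero_smul, zero_add] at hB
    have k := A.comm e₁
    rw [hB, h1] at k
    simp only [map_smul, hB] at k
    have k' := congrArg (fun v => η • v) k
    linear_combination (norm := module) k' - F.sq • (A.T (A.t (swap 1 2) h)) +
      (a * F.sq) • (A.t (swap 1 2) h)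
  have hh0 : h ≠ 0 := by
    rintro rfl
    rw [map_zero] at hTh
    exact F.ne₂ (neg_eq_zero.1 hTh.symm)
  have hu0 : A.t (swap 1 2) h ≠ 0 := fun h' => hh0 (A.perm_injective _ (h'.trans (map_zero _).symm))
  generalize A.t (swap 1 2) h = u at *
  -- T sends `h` out of V_3 but multiplies `u` by a scalar.
  have hind : LinearIndependent K ![h, u] := by
    rw [LinearIndependent.pair_iff]
    intro x y hxy
    have k := congrArg A.T hxy
    rw [map_add, map_smul, map_smul, hTh, hTu, map_zero] at k
    obtain ⟨k1, k2⟩ := F.high_eq_zero (c := -x) ((A.weight {0, 1, 2}).smul_mem (y * a) hu)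
      (by linear_combination (norm := module) k)
    have hx : x = 0 := neg_eq_zero.1 k1
    rw [hx, zero_smul, zero_add] at hxy
    exact ⟨hx, (smul_eq_zero.1 hxy).resolve_right hu0⟩
  obtain ⟨α, β, hαβ⟩ : ∃ α β : K, A.t (swap 0 1) h = α • h + β • u := by
    have hle : Submodule.span K {h, u} ≤ A.weight {0, 1, 2} := by
      rw [Submodule.span_le]
      rintro x (rfl | rfl)
      · exact hh
      · exact hu
    have hrank := finrank_span_eq_card hind
    rw [Matrix.range_cons, Matrix.range_cons, Matrix.range_empty, Set.union_empty,
      Set.singleton_union, Fintype.card_fin] at hrank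
    have heq := Submodule.eq_of_le_of_finrank_le hle (by omega)
    have hmem := A.perm_mem_weight_univ (swap 0 1) hh
    rw [← heq, Submodule.mem_span_pair] at hmem
    obtain ⟨α, β, h⟩ := hmem
    exact ⟨α, β, h.symm⟩
  obtain ⟨u1, u2, u3⟩ := A.mem_weight_univ.1 hu
  -- By the dimension bound, `h` and `u` span V_3. Following `e₂` through the order-three relation
  -- then ends in V_3, although the result must be `e₂`.
  have k := A.order_three e₂
  simp only [w2, hT, hαβ, map_add, map_smul, map_neg, h2', u2, hTh, hTu, F.t01_2, ht01u] at k
  have hv : (α * η * α) • h + (α * η * β + β * a * a * m * m) • u ∈ A.weight {0, 1, 2} :=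
    (A.weight {0, 1, 2}).add_mem ((A.weight {0, 1, 2}).smul_mem _ hh)
      ((A.weight {0, 1, 2}).smul_mem _ hu)
  obtain ⟨c1, -⟩ := F.high_eq_zero (c := -1) hv (by linear_combination (norm := module) k)
  exact one_ne_zero (neg_eq_zero.1 c1)

end IsFrame

end NielsenAction

/-! ### The dichotomy and the list of excluded edges -/

namespace NielsenAction

variable {K V : Type*} [Field K] [AddCommGroup V] [Module K V] (A : NielsenAction K V)

/-- T⁻¹ = `ε 0` T `ε 0` makes the coefficients interact: an edge E_2 → E_1 excludes E_1 → V_0, and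
an edge V_0 → E_1 excludes E_1 → E_2. So edges into and out of E_1 together would give one of the
two-way patterns already refuted. -/
theorem IsFrame.dichotomy {A : NielsenAction K V} [FiniteDimensional K V] {e₀ e₁ e₂ : V} {η : K}
    (F : A.IsFrame e₀ e₁ e₂ η)
    (hdim : A.weight ∅ ≠ ⊥ → Module.finrank K (A.weight {0, 1, 2}) ≤ 2) :
    (∃ s : K, A.T e₀ = s • e₀) ∨
      ((∃ a : K, A.T e₁ = a • e₁) ∧ ∀ z ∈ A.weight ∅, A.T z ∈ A.weight ∅) := by
  obtain ⟨⟨x1, x2, x3⟩, ⟨y1, y2, y3⟩, ⟨w1, w2, w3⟩⟩ := F.eps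
  obtain ⟨s, q, z, hz, h0⟩ := F.T_low x3
  obtain ⟨z1, z2, z3⟩ := A.mem_weight_empty.1 hz
  obtain ⟨r, a, h1⟩ := F.T_e₁
  by_contra hcon
  rw [not_or] at hcon
  obtain ⟨hin, hout⟩ := hcon
  obtain ⟨c1, c2, c3⟩ : r * (a - s) = 0 ∧ a * a - q * r - 1 = 0 ∧ -r • z = 0 := by
    have k := A.inv_right e₁
    simp only [y1, h1, h0, map_add, map_smul, map_neg, x1] at k
    exact F.low_eq_zero ((A.weight ∅).smul_mem (-r) hz) (by linear_combination (norm := module) k)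
  by_cases hr : r = 0
  · subst hr
    rw [zero_smul, zero_add] at h1
    obtain ⟨v, hv, hv'⟩ : ∃ v ∈ A.weight ∅, A.T v ∉ A.weight ∅ := by
      by_contra hall
      push Not at hall
      exact hout ⟨⟨a, h1⟩, hall⟩
    obtain ⟨v1, v2, v3⟩ := A.mem_weight_empty.1 hv
    obtain ⟨p, d, hd, hTv⟩ := F.T_z hv
    obtain ⟨d1, d2, d3⟩ := A.mem_weight_empty.1 hd
    obtain ⟨p', d', hd', hTd⟩ := F.T_z hd
    have hp : p ≠ 0 := by
      rintro rfl
      rw [hTv, zero_smul, zero_add] at hv'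
      exact hv' hd
    have hq : q = 0 := by
      have k := A.inv_right v
      simp only [v1, hTv, map_add, map_smul, map_neg, x1, d1, h0, hTd] at k
      obtain ⟨-, k1, -⟩ := F.low_eq_zero (a := p' - p * s) (b := -p * q)
        ((A.weight ∅).sub_mem ((A.weight ∅).sub_mem hd' ((A.weight ∅).smul_mem p hz)) hv)
        (by linear_combination (norm := module) k)
      exact (mul_eq_zero.1 k1).resolve_left (neg_ne_zero.2 hp)
    subst hq
    rw [zero_smul, add_zero] at h0
    have hz0 : z ≠ 0 := by
      rintro rfl
      exact hin ⟨s, by rw [h0, add_zero]⟩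
    exact F.not_e₀_empty hz hz0 h0 h1 (by linear_combination c2)
      (hdim fun h => hz0 (by rwa [h, Submodule.mem_bot] at hz))
  · have hz0 : z = 0 := (smul_eq_zero.1 c3).resolve_left (neg_ne_zero.2 hr)
    have has : a = s := sub_eq_zero.1 ((mul_eq_zero.1 c1).resolve_left hr)
    subst hz0 has
    rw [add_zero] at h0
    refine F.not_e₀_e₁ h0 h1 (by linear_combination c2) (fun hq => hin ⟨a, ?_⟩) hr
    rw [h0, hq, zero_smul, add_zero]

/-- `T = ρ_{21}` needs no edge from `I` to `J` in a diagram. -/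
def NoEdge (I J : Finset (Fin 3)) : Prop := ∀ v ∈ A.weight I, A.proj J (A.T v) = 0

theorem noEdge_of_weight_eq_bot_left {I J : Finset (Fin 3)} (h : A.weight I = ⊥) :
    A.NoEdge I J := by
  intro v hv
  rw [h, Submodule.mem_bot] at hv
  rw [hv, map_zero, map_zero]

theorem noEdge_of_weight_eq_bot_right {I J : Finset (Fin 3)} (h : A.weight J = ⊥) :
    A.NoEdge I J :=
  fun _ _ => A.proj_eq_zero h _

/-- T commutes with `ε 2` and so preserves its eigenspaces. -/
theorem noEdge_of_not_iff (h2 : (2 : K) ≠ 0) {I J : Finset (Fin 3)} (h : ¬ (2 ∈ I ↔ 2 ∈ J)) :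
    A.NoEdge I J := by
  intro v hv
  have k := A.eps_proj 2 J (A.T v)
  rw [A.eps_two, A.mem_weight.1 (A.proj_mem J _), A.mem_weight.1 hv, map_smul, map_smul] at k
  refine (smul_eq_zero.1 (?_ : (2 : K) • A.proj J (A.T v) = 0)).resolve_left h2
  by_cases hI : 2 ∈ I <;> by_cases hJ : 2 ∈ J
  · exact absurd (iff_of_true hI hJ) h
  · simp only [hI, hJ, if_true, if_false] at k
    linear_combination (norm := module) k
  · simp only [hI, hJ, if_true, if_false] at k
    linear_combination (norm := module) -k
  · exact absurd (iff_of_false hI hJ) h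

/-- The edges of `lowDiagramIn` other than loops. -/
abbrev lowIn : Set (Finset (Fin 3) × Finset (Fin 3)) :=
  {({0, 1, 2}, {2}), ({2}, {0, 1, 2}), ({1}, {0}), (∅, {0})}

/-- The edges of `lowDiagramOut` other than loops. -/
abbrev lowOut : Set (Finset (Fin 3) × Finset (Fin 3)) :=
  {({0, 1, 2}, {2}), ({2}, {0, 1, 2}), ({0}, {1}), ({0}, ∅)}

theorem pair_cases : ∀ I J : Finset (Fin 3), I = J ∨ I.card = 2 ∨ J.card = 2 ∨
    ¬ (2 ∈ I ↔ 2 ∈ J) ∨ (I = {0, 1, 2} ∧ J = {2}) ∨ (I = {2} ∧ J = {0, 1, 2}) ∨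
    (I = {1} ∧ J = {0}) ∨ (I = ∅ ∧ J = {0}) ∨ (I = {0} ∧ J = {1}) ∨ (I = {0} ∧ J = ∅) ∨
    (I = {1} ∧ J = ∅) ∨ (I = ∅ ∧ J = {1}) := by
  decide

theorem noEdge_lowIn (h2 : (2 : K) ≠ 0)
    (hV2 : ∀ I : Finset (Fin 3), I.card = 2 → A.weight I = ⊥)
    (h01 : A.NoEdge {0} {1}) (h0 : A.NoEdge {0} ∅) (h1 : A.NoEdge {1} ∅) (h1' : A.NoEdge ∅ {1}) :
    ∀ I J, I ≠ J → (I, J) ∉ lowIn → A.NoEdge I J := by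
  intro I J hIJ hmem
  rcases pair_cases I J with h | h | h | h | ⟨rfl, rfl⟩ | ⟨rfl, rfl⟩ | ⟨rfl, rfl⟩ | ⟨rfl, rfl⟩ |
    ⟨rfl, rfl⟩ | ⟨rfl, rfl⟩ | ⟨rfl, rfl⟩ | ⟨rfl, rfl⟩
  · exact absurd h hIJ
  · exact A.noEdge_of_weight_eq_bot_left (hV2 I h)
  · exact A.noEdge_of_weight_eq_bot_right (hV2 J h)
  · exact A.noEdge_of_not_iff h2 h
  all_goals first | assumption | exact absurd (by simp) hmem

theorem noEdge_lowOut (h2 : (2 : K) ≠ 0)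
    (hV2 : ∀ I : Finset (Fin 3), I.card = 2 → A.weight I = ⊥)
    (h10 : A.NoEdge {1} {0}) (h0 : A.NoEdge ∅ {0}) (h1 : A.NoEdge {1} ∅) (h1' : A.NoEdge ∅ {1}) :
    ∀ I J, I ≠ J → (I, J) ∉ lowOut → A.NoEdge I J := by
  intro I J hIJ hmem
  rcases pair_cases I J with h | h | h | h | ⟨rfl, rfl⟩ | ⟨rfl, rfl⟩ | ⟨rfl, rfl⟩ | ⟨rfl, rfl⟩ |
    ⟨rfl, rfl⟩ | ⟨rfl, rfl⟩ | ⟨rfl, rfl⟩ | ⟨rfl, rfl⟩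
  · exact absurd h hIJ
  · exact A.noEdge_of_weight_eq_bot_left (hV2 I h)
  · exact A.noEdge_of_weight_eq_bot_right (hV2 J h)
  · exact A.noEdge_of_not_iff h2 h
  all_goals first | assumption | exact absurd (by simp) hmem

/-! ### Dimension counts and the case V_2 = 0 -/

section Dimensions

variable [FiniteDimensional K V]

theorem finrank_weight_le (σ : Equiv.Perm (Fin 3)) (I : Finset (Fin 3)) :
    Module.finrank K (A.weight I) ≤ Module.finrank K (A.weight (I.map σ.toEmbedding)) := by
  rw [(Submodule.equivMapOfInjective (A.t σ) (A.perm_injective σ) (A.weight I)).finrank_eq]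
  refine Submodule.finrank_mono ?_
  rintro _ ⟨v, hv, rfl⟩
  exact A.perm_mem_weight σ hv

theorem finrank_weight_map (σ : Equiv.Perm (Fin 3)) (I : Finset (Fin 3)) :
    Module.finrank K (A.weight (I.map σ.toEmbedding)) = Module.finrank K (A.weight I) := by
  refine le_antisymm ?_ (A.finrank_weight_le σ I)
  have h := A.finrank_weight_le σ.symm (I.map σ.toEmbedding)
  have h' : (I.map σ.toEmbedding).map σ.symm.toEmbedding = I := by
    ext i
    simp
  rwa [h'] at h

theorem finrank_weight_eq : ∀ I J : Finset (Fin 3), I.card = J.card →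
    Module.finrank K (A.weight I) = Module.finrank K (A.weight J) := by
  intro I J h
  obtain ⟨σ, hσ⟩ : ∃ σ : Equiv.Perm (Fin 3), I.map σ.toEmbedding = J := by
    revert I J
    decide
  rw [← hσ, A.finrank_weight_map]

theorem sum_finrank_weight_le (h2 : (2 : K) ≠ 0) (s : Finset (Finset (Fin 3))) (W : Submodule K V)
    (hW : ∀ I ∈ s, A.weight I ≤ W) :
    ∑ I ∈ s, Module.finrank K (A.weight I) ≤ Module.finrank K W := by
  have key : ∀ s : Finset (Finset (Fin 3)),
      Module.finrank K ↥(s.sup A.weight) = ∑ I ∈ s, Module.finrank K (A.weight I) := by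
    intro s
    induction s using Finset.induction_on with
    | empty => simp
    | insert I s hI ih =>
      rw [Finset.sum_insert hI, ← ih, Finset.sup_insert, ← Submodule.finrank_sup_add_finrank_inf_eq]
      have hdisj : A.weight I ⊓ s.sup A.weight = ⊥ := by
        refine disjoint_iff.1 ((A.iSupIndep_weight h2 I).mono_right (Finset.sup_le fun J hJ => ?_))
        exact le_iSup₂_of_le J (fun h => hI (h ▸ hJ)) le_rfl
      rw [hdisj, finrank_bot, add_zero]
  rw [← key]
  exact Submodule.finrank_mono (Finset.sup_le hW)

theorem finrank_weight_bound (h2 : (2 : K) ≠ 0) (h6 : Module.finrank K V = 6) :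
    3 * Module.finrank K (A.weight {0}) + Module.finrank K (A.weight ∅) +
      Module.finrank K (A.weight {0, 1, 2}) ≤ 6 := by
  have h := A.sum_finrank_weight_le h2 {{0}, {1}, {2}, ∅, {0, 1, 2}} ⊤ fun _ _ => le_top
  rw [finrank_top, h6] at h
  repeat rw [Finset.sum_insert (by decide)] at h
  rw [Finset.sum_singleton, A.finrank_weight_eq {1} {0} rfl, A.finrank_weight_eq {2} {0} rfl] at h
  omega

theorem noEdge_low (h2 : (2 : K) ≠ 0) (h6 : Module.finrank K V = 6)
    (hV2 : ∀ I : Finset (Fin 3), I.card = 2 → A.weight I = ⊥)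
    (h1 : Module.finrank K (A.weight {0}) ≤ 1) :
    (∀ I J, I ≠ J → (I, J) ∉ lowIn → A.NoEdge I J) ∨
    (∀ I J, I ≠ J → (I, J) ∉ lowOut → A.NoEdge I J) := by
  by_cases h0 : Module.finrank K (A.weight {0}) = 0
  · have e0 : A.weight {0} = ⊥ := Submodule.finrank_eq_zero.1 h0
    have e1 : A.weight {1} = ⊥ :=
      Submodule.finrank_eq_zero.1 ((A.finrank_weight_eq {1} {0} rfl).trans h0)
    exact Or.inl (A.noEdge_lowIn h2 hV2 (A.noEdge_of_weight_eq_bot_left e0)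
      (A.noEdge_of_weight_eq_bot_left e0) (A.noEdge_of_weight_eq_bot_left e1)
      (A.noEdge_of_weight_eq_bot_right e1))
  obtain ⟨e₀, e₁, e₂, η, F⟩ := A.exists_isFrame h2 hV2 (by omega)
  have hbound := A.finrank_weight_bound h2 h6
  -- If V_0 ≠ 0, then 3 + 1 + dim V_3 ≤ 6; this is where dimension six enters.
  have d := F.dichotomy fun h => by
    have : Module.finrank K (A.weight ∅) ≠ 0 := fun h' => h (Submodule.finrank_eq_zero.1 h')
    omega
  have p : ∀ {I J : Finset (Fin 3)} {v : V}, v ∈ A.weight I → I ≠ J → A.proj J v = 0 :=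
    fun hv hne => by rw [A.proj_of_mem h2 hv, if_neg hne]
  obtain ⟨r, a, hr⟩ := F.T_e₁
  have n1 : A.NoEdge {1} ∅ := by
    intro v hv
    obtain ⟨c, rfl⟩ := F.span₁ v hv
    simp only [map_smul, hr, map_add, p F.mem₀ (show ({0} : Finset (Fin 3)) ≠ ∅ by decide),
      p F.mem₁ (show ({1} : Finset (Fin 3)) ≠ ∅ by decide), smul_zero, add_zero]
  have n2 : A.NoEdge ∅ {1} := by
    intro v hv
    obtain ⟨c, d, hd, hT⟩ := F.T_z hv
    simp only [map_smul, hT, map_add, p F.mem₀ (show ({0} : Finset (Fin 3)) ≠ {1} by decide),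
      p hd (show (∅ : Finset (Fin 3)) ≠ {1} by decide), smul_zero, add_zero]
  rcases d with ⟨s, hs⟩ | ⟨⟨b, hb⟩, hz⟩
  · have n3 : ∀ J : Finset (Fin 3), {0} ≠ J → A.NoEdge {0} J := by
      intro J hJ v hv
      obtain ⟨c, rfl⟩ := F.span₀ v hv
      simp only [map_smul, hs, p F.mem₀ hJ, smul_zero]
    exact Or.inl (A.noEdge_lowIn h2 hV2 (n3 _ (by decide)) (n3 _ (by decide)) n1 n2)
  · have n3 : A.NoEdge {1} {0} := by
      intro v hv
      obtain ⟨c, rfl⟩ := F.span₁ v hv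
      simp only [map_smul, hb, p F.mem₁ (show ({1} : Finset (Fin 3)) ≠ {0} by decide), smul_zero]
    exact Or.inr (A.noEdge_lowOut h2 hV2 n3 (fun v hv => p (hz v hv) (by decide)) n1 n2)

end Dimensions

/-! ### Tensoring with the determinant -/

section Twist

/-- The tensor product with the determinant representation. -/
def twist : NielsenAction K V where
  ε i := -A.ε i
  t :=
    { toFun := fun σ => ((Equiv.Perm.sign σ : ℤ) : K) • A.t σ
      map_one' := by simp
      map_mul' := fun σ τ => by
        rw [map_mul, map_mul, Units.val_mul, Int.cast_mul, smul_mul_smul_comm] }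
  T := A.T
  eps_eps i v := by simp [A.eps_eps]
  eps_comm i j v := by simp [A.eps_comm i j]
  perm_eps σ i v := by simp [A.perm_eps]
  eps_two v := by simp [A.eps_two]
  inv_left v := by simp [A.inv_left]
  inv_right v := by simp [A.inv_right]
  comm_self v := by simp [A.comm_self]
  -- In this and the following relations each side contains an even number of sign changes and
  -- transpositions in total, so the determinant signs cancel.
  partial_conj v := by simpa [Equiv.Perm.sign_swap] using A.partial_conj v
  order_three v := by simpa [Equiv.Perm.sign_swap] using A.order_three v
  comm v := by simpa [Equiv.Perm.sign_swap] using A.comm v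
  comm_left v := by simpa [Equiv.Perm.sign_swap] using A.comm_left v
  steinberg v := by simpa [Equiv.Perm.sign_swap] using A.steinberg v

theorem weight_twist (I : Finset (Fin 3)) : A.twist.weight I = A.weight Iᶜ := by
  ext v
  rw [mem_weight, mem_weight]
  refine forall_congr' fun i => ?_
  by_cases h : i ∈ I <;> simp [twist, h, neg_eq_iff_eq_neg]

theorem proj_twist (J : Finset (Fin 3)) : A.twist.proj J = A.proj Jᶜ := by
  have h : ∀ i, A.twist.halfProj i J = A.halfProj i Jᶜ := by
    intro i
    by_cases hi : i ∈ J <;> simp [twist, halfProj, hi]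
  rw [proj, proj, h, h, h]

theorem noEdge_twist (I J : Finset (Fin 3)) : A.twist.NoEdge I J ↔ A.NoEdge Iᶜ Jᶜ := by
  rw [NoEdge, NoEdge, weight_twist, proj_twist]
  rfl

end Twist

end NielsenAction

/-! ### Representations of Out(F_3) and their diagrams -/

variable {K V : Type*} [Field K] [AddCommGroup V] [Module K V] (φ : Representation K (Out 3) V)

theorem rep_mk_mk (f g : MulAut (FreeGroup (Fin 3))) (v : V) :
    φ (QuotientGroup.mk f) (φ (QuotientGroup.mk g) v) = φ (QuotientGroup.mk (f * g)) v := by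
  rw [QuotientGroup.mk_mul, map_mul, Module.End.mul_apply]

/-- The operators of a representation of `Out(F_3)` given by the Nielsen generators. -/
def nielsenAction : NielsenAction K V where
  ε i := φ (eps i)
  t := (φ.comp (QuotientGroup.mk' _)).comp permAut
  T := φ (rho 1 0 (by decide))
  eps_eps i v := by simp [eps, rep_mk_mk, epsAut_mul_self]
  eps_comm i j v := by simp only [eps, rep_mk_mk, epsAut_mul_comm]
  perm_eps σ i v := by
    change φ (QuotientGroup.mk _) (φ (QuotientGroup.mk _) v) =
      φ (QuotientGroup.mk _) (φ (QuotientGroup.mk _) v)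
    rw [rep_mk_mk, rep_mk_mk, permAut_mul_epsAut]
  eps_two v := by simp only [eps, rho, rep_mk_mk, epsAut_two_mul_rhoAut]
  inv_left v := by
    simp only [eps, rho, rep_mk_mk, ← mul_assoc, epsAut_zero_mul_rhoAut, QuotientGroup.mk_one,
      map_one, Module.End.one_apply]
  inv_right v := by
    simp only [eps, rho, rep_mk_mk, ← mul_assoc, rhoAut_mul_epsAut_zero, QuotientGroup.mk_one,
      map_one, Module.End.one_apply]
  comm_self v := by simp only [eps, rho, rep_mk_mk, ← mul_assoc, rhoAut_comm_left_self]
  partial_conj v := by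
    simp only [MonoidHom.comp_apply, QuotientGroup.mk'_apply, eps, rho, rep_mk_mk]
    refine (congrArg (fun g => φ g v) (mk_eq_mk_of_conj _ 1 (FreeGroup.of 0)⁻¹ fun k => ?_)).trans
      (by simp)
    fin_cases k <;> simp [epsAut_of, rhoAut_of, Equiv.swap_apply_def, mul_assoc]
  order_three v := by
    simp only [MonoidHom.comp_apply, QuotientGroup.mk'_apply, eps, rho, rep_mk_mk]
    refine (congrArg (fun g => φ (QuotientGroup.mk g) v) (mulAut_ext (g := 1) fun k => ?_)).trans
      (by simp)
    fin_cases k <;> simp [epsAut_of, rhoAut_of, Equiv.swap_apply_def, mul_assoc]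
  comm v := by
    simp only [MonoidHom.comp_apply, QuotientGroup.mk'_apply, rho, rep_mk_mk]
    refine congrArg (fun g => φ (QuotientGroup.mk g) v) (mulAut_ext fun k => ?_)
    fin_cases k <;> simp [rhoAut_of, Equiv.swap_apply_def]
  comm_left v := by
    simp only [MonoidHom.comp_apply, QuotientGroup.mk'_apply, eps, rho, rep_mk_mk]
    refine congrArg (fun g => φ (QuotientGroup.mk g) v) (mulAut_ext fun k => ?_)
    fin_cases k <;> simp [epsAut_of, rhoAut_of, Equiv.swap_apply_def, mul_assoc]
  steinberg v := by
    simp only [MonoidHom.comp_apply, QuotientGroup.mk'_apply, rho, rep_mk_mk]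
    refine congrArg (fun g => φ (QuotientGroup.mk g) v) (mulAut_ext fun k => ?_)
    fin_cases k <;> simp [rhoAut_of, Equiv.swap_apply_def, mul_assoc]

theorem weight_nielsenAction (I : Finset (Fin 3)) : (nielsenAction φ).weight I = weightSpace φ I :=
  rfl

theorem weight_le_level (I : Finset (Fin 3)) : (nielsenAction φ).weight I ≤ level φ I.card := by
  rw [weight_nielsenAction, level]
  exact le_iSup₂ (f := fun J (_ : J.card = I.card) => weightSpace φ J) I rfl

theorem level_eq_bot_iff (m : ℕ) :
    level φ m = ⊥ ↔ ∀ I : Finset (Fin 3), I.card = m → (nielsenAction φ).weight I = ⊥ := by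
  simp only [level, iSup_eq_bot, weight_nielsenAction]

theorem isDiagramFor_withLoops (h2 : (2 : K) ≠ 0) {S : Set (Finset (Fin 3))}
    {L : Set (Finset (Fin 3) × Finset (Fin 3))} (hS : ∀ I, weightSpace φ I ≠ ⊥ → I ∈ S)
    (hL : ∀ I J, I ≠ J → (I, J) ∉ L → (nielsenAction φ).NoEdge I J) :
    IsDiagramFor φ (rho 1 0 (by decide)) (Diagram.withLoops S L) := by
  refine ⟨hS, ?_⟩
  rintro I J ⟨hI, hJ, v, hv, w, hw, hwJ⟩
  refine ⟨hS I hI, hS J hJ, ?_⟩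
  by_contra hcon
  rw [not_or] at hcon
  have h1 := hL I J hcon.1 hcon.2 v hv
  exact hwJ (Subtype.ext (((nielsenAction φ).sum_eq_proj h2 w hw J).trans h1))

theorem noEdge_of_isDiagramFor (h2 : (2 : K) ≠ 0) {D : Diagram 3}
    (hD : IsDiagramFor φ (rho 1 0 (by decide)) D) {I J : Finset (Fin 3)} (h : ¬ D.edge I J) :
    (nielsenAction φ).NoEdge I J := by
  intro v hv
  by_contra hne
  refine h (hD.2 I J ⟨fun hI => ?_, fun hJ => hne ((nielsenAction φ).proj_eq_zero hJ _), v, hv,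
    fun L => ⟨_, (nielsenAction φ).proj_mem L _⟩, ((nielsenAction φ).sum_proj h2 _).symm,
    fun h0 => hne (congrArg Subtype.val h0)⟩)
  exact hne ((nielsenAction φ).noEdge_of_weight_eq_bot_left hI v hv)

/-! ### Invariant subspaces -/

section Invariance

/-- The automorphisms whose classes stabilize a subspace. -/
def stabilizer (W : Submodule K V) : Subgroup (MulAut (FreeGroup (Fin 3))) where
  carrier := {g | (∀ v ∈ W, φ (QuotientGroup.mk g) v ∈ W) ∧
    ∀ v ∈ W, φ (QuotientGroup.mk g⁻¹) v ∈ W}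
  one_mem' := by simp
  mul_mem' := by
    rintro f g ⟨hf, hf'⟩ ⟨hg, hg'⟩
    refine ⟨fun v hv => ?_, fun v hv => ?_⟩
    · rw [← rep_mk_mk]
      exact hf _ (hg v hv)
    · rw [mul_inv_rev, ← rep_mk_mk]
      exact hg' _ (hf' v hv)
  inv_mem' := by
    rintro g ⟨hg, hg'⟩
    exact ⟨hg', by rwa [inv_inv]⟩

/-- Sign changes preserve each E_I, permutations preserve |I|, and T preserves the sum by
hypothesis, as does T⁻¹ = `ε 0` T `ε 0`. Every ρ_ij is conjugate to ρ_21 by a permutation, so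
Nielsen's theorem applies. -/
theorem isInvariant_of_noEdge (h2 : (2 : K) ≠ 0) (m n : ℕ)
    (h : ∀ I J : Finset (Fin 3), (I.card = m ∨ I.card = n) → ¬ (J.card = m ∨ J.card = n) →
      (nielsenAction φ).NoEdge I J) :
    IsInvariant φ (level φ m ⊔ level φ n) := by
  set A := nielsenAction φ
  set W := level φ m ⊔ level φ n
  have hle : ∀ I : Finset (Fin 3), (I.card = m ∨ I.card = n) → A.weight I ≤ W := by
    rintro I (rfl | rfl)
    · exact (weight_le_level φ I).trans le_sup_left
    · exact (weight_le_level φ I).trans le_sup_right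
  have hmap : ∀ f : Module.End K V, (∀ I : Finset (Fin 3), (I.card = m ∨ I.card = n) →
      ∀ v ∈ A.weight I, f v ∈ W) → ∀ v ∈ W, f v ∈ W := by
    intro f hf
    have : W ≤ W.comap f := by
      refine sup_le (iSup₂_le fun I hI => ?_) (iSup₂_le fun I hI => ?_)
      · exact hf I (Or.inl hI)
      · exact hf I (Or.inr hI)
    exact this
  have hε : ∀ i, ∀ v ∈ W, A.ε i v ∈ W := fun i => hmap _ fun I hI v hv => by
    rw [A.mem_weight.1 hv]
    exact W.smul_mem _ (hle I hI hv)
  have ht : ∀ σ, ∀ v ∈ W, A.t σ v ∈ W := fun σ => hmap _ fun I hI v hv =>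
    hle _ (by rwa [Finset.card_map]) (A.perm_mem_weight σ hv)
  have hT : ∀ v ∈ W, A.T v ∈ W := hmap _ fun I hI v hv => by
    rw [← A.sum_proj h2 (A.T v)]
    refine W.sum_mem fun J _ => ?_
    by_cases hJ : J.card = m ∨ J.card = n
    · exact hle J hJ (A.proj_mem J _)
    · rw [h I J hI hJ v hv]
      exact W.zero_mem
  have mε : ∀ i, epsAut i ∈ stabilizer φ W := fun i => by
    refine ⟨hε i, ?_⟩
    rw [inv_eq_of_mul_eq_one_left (epsAut_mul_self i)]
    exact hε i
  have mσ : ∀ σ, permAut σ ∈ stabilizer φ W := fun σ => by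
    refine ⟨ht σ, ?_⟩
    rw [← map_inv]
    exact ht σ⁻¹
  have mT : rhoAut 1 0 (by decide) ∈ stabilizer φ W := by
    refine ⟨hT, fun v hv => ?_⟩
    rw [inv_eq_of_mul_eq_one_left epsAut_zero_mul_rhoAut, ← rep_mk_mk, ← rep_mk_mk]
    exact hε 0 _ (hT _ (hε 0 v hv))
  have mρ : ∀ i j h, rhoAut i j h ∈ stabilizer φ W := by
    intro i j hij
    obtain ⟨σ, rfl, rfl⟩ : ∃ σ : Equiv.Perm (Fin 3), σ 1 = i ∧ σ 0 = j := by
      revert i j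
      decide
    refine (Subgroup.mul_mem_cancel_right _ (mσ σ)).1 ?_
    rw [← permAut_mul_rhoAut σ 1 0 (by decide)]
    exact Subgroup.mul_mem _ (mσ σ) mT
  have htop := subgroup_eq_top mε mσ mρ
  intro g v hv
  obtain ⟨g, rfl⟩ := QuotientGroup.mk_surjective g
  have : g ∈ stabilizer φ W := htop ▸ Subgroup.mem_top g
  exact this.1 v hv

end Invariance

theorem card_of_low_edge_in {I J : Finset (Fin 3)} (h : lowDiagramIn.edge I J) :
    (I.card = 1 ∨ I.card = 3) → (J.card = 1 ∨ J.card = 3) := by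
  obtain ⟨-, -, h⟩ := h
  simp only [Set.mem_insert_iff, Set.mem_singleton_iff, Prod.mk.injEq] at h
  revert I J
  decide

theorem card_of_low_edge_out {I J : Finset (Fin 3)} (h : lowDiagramOut.edge I J) :
    (I.card = 0 ∨ I.card = 2) → (J.card = 0 ∨ J.card = 2) := by
  obtain ⟨-, -, h⟩ := h
  simp only [Set.mem_insert_iff, Set.mem_singleton_iff, Prod.mk.injEq] at h
  revert I J
  decide

theorem card_of_high_edge_in {I J : Finset (Fin 3)} (h : highDiagramIn.edge I J) :
    (I.card = 0 ∨ I.card = 2) → (J.card = 0 ∨ J.card = 2) := by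
  obtain ⟨-, -, h⟩ := h
  simp only [Set.mem_insert_iff, Set.mem_singleton_iff, Prod.mk.injEq] at h
  revert I J
  decide

theorem card_of_high_edge_out {I J : Finset (Fin 3)} (h : highDiagramOut.edge I J) :
    (I.card = 1 ∨ I.card = 3) → (J.card = 1 ∨ J.card = 3) := by
  obtain ⟨-, -, h⟩ := h
  simp only [Set.mem_insert_iff, Set.mem_singleton_iff, Prod.mk.injEq] at h
  revert I J
  decide

/-! ### The diagrams in dimension six -/

section SixDimensional

variable {φ} [FiniteDimensional K V]

theorem low_diagram (h2 : (2 : K) ≠ 0) (h6 : Module.finrank K V = 6) (hV2 : level φ 2 = ⊥)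
    (h1 : Module.finrank K ((nielsenAction φ).weight {0}) ≤ 1) :
    IsDiagramFor φ (rho 1 0 (by decide)) lowDiagramIn ∨
      IsDiagramFor φ (rho 1 0 (by decide)) lowDiagramOut := by
  have hV2' := (level_eq_bot_iff φ 2).1 hV2
  have hS : ∀ I, weightSpace φ I ≠ ⊥ → I ∈ lowVerts := by
    intro I hI
    have hc : I.card ≠ 2 := fun h => hI (hV2' I h)
    simp only [lowVerts, Set.mem_insert_iff, Set.mem_singleton_iff]
    clear hI
    revert I
    decide
  exact ((nielsenAction φ).noEdge_low h2 h6 hV2' h1).imp (isDiagramFor_withLoops φ h2 hS)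
    (isDiagramFor_withLoops φ h2 hS)

theorem high_diagram (h2 : (2 : K) ≠ 0) (h6 : Module.finrank K V = 6) (hV1 : level φ 1 = ⊥)
    (h1 : Module.finrank K ((nielsenAction φ).weight {1, 2}) ≤ 1) :
    IsDiagramFor φ (rho 1 0 (by decide)) highDiagramIn ∨
      IsDiagramFor φ (rho 1 0 (by decide)) highDiagramOut := by
  have hV1' := (level_eq_bot_iff φ 1).1 hV1
  have hS : ∀ I, weightSpace φ I ≠ ⊥ → I ∈ highVerts := by
    intro I hI
    have hc : I.card ≠ 1 := fun h => hI (hV1' I h)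
    simp only [highVerts, Set.mem_insert_iff, Set.mem_singleton_iff]
    clear hI
    revert I
    decide
  -- The twist replaces every vertex by its complement, which carries the two low diagrams to the
  -- two high ones.
  have hcompl : ∀ {L L' : Set (Finset (Fin 3) × Finset (Fin 3))},
      (∀ I J, (Iᶜ, Jᶜ) ∈ L → (I, J) ∈ L') →
      (∀ I J, I ≠ J → (I, J) ∉ L → (nielsenAction φ).twist.NoEdge I J) →
      ∀ I J, I ≠ J → (I, J) ∉ L' → (nielsenAction φ).NoEdge I J := by
    intro L L' hL hE I J hIJ hmem
    have := hE Iᶜ Jᶜ (compl_injective.ne hIJ) fun h => hmem (hL I J h)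
    rwa [NielsenAction.noEdge_twist, compl_compl, compl_compl] at this
  have h := (nielsenAction φ).twist.noEdge_low h2 h6
    (fun I hI => by
      rw [NielsenAction.weight_twist]
      exact hV1' _ (by rw [Finset.card_compl, hI]; rfl))
    (by rw [NielsenAction.weight_twist]; exact h1)
  refine h.imp (fun h => isDiagramFor_withLoops φ h2 hS (hcompl ?_ h))
    (fun h => isDiagramFor_withLoops φ h2 hS (hcompl ?_ h))
  all_goals
    simp only [Set.mem_insert_iff, Set.mem_singleton_iff, Prod.mk.injEq]
    decide

end SixDimensional

end OutFree

theorem mainTheorem6 {K V : Type*} [Field K] (hK : ringChar K ≠ 2) [AddCommGroup V] [Module K V]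
    (φ : Representation K (OutFree.Out 3) V) (hdim : Module.finrank K V = 6)
    (h12 : Module.finrank K ↥(OutFree.level φ 1 ⊔ OutFree.level φ 2) ≤ 3) :
    (OutFree.level φ 1 = ⊥ ∨ OutFree.level φ 2 = ⊥) ∧
    (OutFree.level φ 2 = ⊥ →
      OutFree.IsDiagramFor φ (OutFree.rho 1 0 (by decide)) OutFree.lowDiagramIn ∨
      OutFree.IsDiagramFor φ (OutFree.rho 1 0 (by decide)) OutFree.lowDiagramOut) ∧
    (OutFree.level φ 1 = ⊥ →
      OutFree.IsDiagramFor φ (OutFree.rho 1 0 (by decide)) OutFree.highDiagramIn ∨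
      OutFree.IsDiagramFor φ (OutFree.rho 1 0 (by decide)) OutFree.highDiagramOut) ∧
    (OutFree.IsInvariant φ (OutFree.level φ 0 ⊔ OutFree.level φ 2) ∨
      OutFree.IsInvariant φ (OutFree.level φ 1 ⊔ OutFree.level φ 3)) := by
  have h2 : (2 : K) ≠ 0 := Ring.two_ne_zero hK
  -- `Module.finrank` is 0 on infinite-dimensional spaces, so the value 6 includes finiteness.
  have : FiniteDimensional K V := Module.finite_of_finrank_pos (by omega)
  let A := OutFree.nielsenAction φ
  -- After identifying equal dimensions this reads 3 dim E_1 + 3 dim E_{2,3} ≤ 3.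
  have hsum := A.sum_finrank_weight_le h2 {{0}, {1}, {2}, {0, 1}, {0, 2}, {1, 2}}
    (OutFree.level φ 1 ⊔ OutFree.level φ 2) (by
      intro I hI
      have hI : I.card = 1 ∨ I.card = 2 := by
        revert I
        decide
      refine (OutFree.weight_le_level φ I).trans ?_
      rcases hI with hI | hI <;> rw [hI]
      · exact le_sup_left
      · exact le_sup_right)
  repeat rw [Finset.sum_insert (by decide)] at hsum
  rw [Finset.sum_singleton, A.finrank_weight_eq {1} {0} rfl, A.finrank_weight_eq {2} {0} rfl,
    A.finrank_weight_eq {0, 1} {1, 2} rfl, A.finrank_weight_eq {0, 2} {1, 2} rfl] at hsum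
  have hlow := fun h => OutFree.low_diagram (φ := φ) h2 hdim h
    (show Module.finrank K (A.weight {0}) ≤ 1 by omega)
  have hhigh := fun h => OutFree.high_diagram (φ := φ) h2 hdim h
    (show Module.finrank K (A.weight {1, 2}) ≤ 1 by omega)
  have h1or2 : OutFree.level φ 1 = ⊥ ∨ OutFree.level φ 2 = ⊥ := by
    rw [OutFree.level_eq_bot_iff, OutFree.level_eq_bot_iff]
    rcases (show Module.finrank K (A.weight {0}) = 0 ∨ Module.finrank K (A.weight {1, 2}) = 0 by
      omega) with h | h
    · exact Or.inl fun I hI =>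
        Submodule.finrank_eq_zero.1 ((A.finrank_weight_eq I {0} (by rw [hI]; rfl)).trans h)
    · exact Or.inr fun I hI =>
        Submodule.finrank_eq_zero.1 ((A.finrank_weight_eq I {1, 2} (by rw [hI]; rfl)).trans h)
  refine ⟨h1or2, hlow, hhigh, ?_⟩
  rcases h1or2 with h | h
  · rcases hhigh h with hD | hD
    · exact Or.inl (OutFree.isInvariant_of_noEdge φ h2 0 2 fun I J hI hJ =>
        OutFree.noEdge_of_isDiagramFor φ h2 hD fun he =>
          hJ (OutFree.card_of_high_edge_in he hI))
    · exact Or.inr (OutFree.isInvariant_of_noEdge φ h2 1 3 fun I J hI hJ =>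
        OutFree.noEdge_of_isDiagramFor φ h2 hD fun he =>
          hJ (OutFree.card_of_high_edge_out he hI))
  · rcases hlow h with hD | hD
    · exact Or.inr (OutFree.isInvariant_of_noEdge φ h2 1 3 fun I J hI hJ =>
        OutFree.noEdge_of_isDiagramFor φ h2 hD fun he =>
          hJ (OutFree.card_of_low_edge_in he hI))
    · exact Or.inl (OutFree.isInvariant_of_noEdge φ h2 0 2 fun I J hI hJ =>
        OutFree.noEdge_of_isDiagramFor φ h2 hD fun he =>
          hJ (OutFree.card_of_low_edge_out he hI))
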